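/- Let $G$ be a cubic graph, i.e. a finite simple graph with $n\ge 1$ vertices, each of degree $3$ ($G$ need not be connected), and let $\lambda_1,\dots,\lambda_n$ be the eigenvalues of its adjacency matrix, listed with multiplicity. Consider oriented closed paths $(v_1,\dots,v_\ell,v_1)$ in $G$ (consecutive vertices adjacent; constant paths have length $0$) up to cyclic permutation of the vertices; the length is the number $\ell$ of edges. An elementary homotopy is $(v_1,\dots,v_j,\dots,v_\ell,v_1)\mapsto(v_1,\dots,v_j,v',v_j,\dots,v_\ell,v_1)$ with $v'$ adjacent to $v_j$, and two closed paths are freely homotopic if they are connected by a finite sequence of elementary homotopies and their inverses. A closed geodesic is a closed path of positive length that is shortest in its free homotopy class; it is primitive if it is not a power of a shorter closed geodesic. Let $m_\ell$ be the number of non-oriented primitive closed geodesics of length $\ell$ (a geodesic and its reverse being identified). For $t\in\mathbb R$ put $$J(t)=\frac{3}{2\pi}\int_{-2\sqrt2}^{2\sqrt2}e^{st}\,\frac{\sqrt{8-s^2}}{9-s^2}\,ds,\qquad F_\ell(t)=\sum_{k=1}^\infty\frac{I_{k\ell}(2\sqrt2\,t)}{2^{k\ell/2}},\qquad I_m(z)=\sum_{r=0}^\infty\frac{(z/2)^{m+2r}}{r!\,(m+r)!}.$$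 Then every closed geodesic has length at least $3$, every $m_\ell$ is finite, the integrand of $J(t)$ is integrable, the series for $I_m(z)$ ($m\ge0$, $z\in\mathbb R$) and for $F_\ell(t)$ ($\ell\ge3$) and the series $\sum_{\ell\ge3}\ell m_\ell F_\ell(t)$ converge absolutely, and for every $t\in\mathbb R$ $$\frac1n\sum_{i=1}^n e^{t\lambda_i}=J(t)+\frac2n\sum_{\ell=3}^\infty \ell\, m_\ell\, F_\ell(t).$$ In particular the mean $\mu=\frac1n\sum_{i=1}^n e^{\lambda_i/3}$ is $$\mu=J(1/3)+\frac2n\sum_{\ell=3}^\infty \ell\, m_\ell\, F_\ell(1/3),$$ and the variance $\sigma=\frac1n\sum_{i=1}^n\left(e^{\lambda_i/3}-\mu\right)^2$ is $$\sigma=J(2/3)+\frac2n\sum_{\ell=3}^\infty \ell\, m_\ell\, F_\ell(2/3)-\mu^2 =\left(J(2/3)-J(1/3)^2\right)+\frac2n\sum_{\ell=3}^\infty \ell\, m_\ell\left(F_\ell(2/3)-2J(1/3)F_\ell(1/3)\right)-\left(\frac2n\sum_{\ell=3}^\infty \ell\, m_\ell\, F_\ell(1/3)\right)^2 .$$ 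-/

import Mathlib

open scoped Nat

noncomputable section

namespace CubicTrace

universe u

variable {V : Type u}

/-- A closed path with a distinguished starting vertex: `(v₁, v₂, …, v_ℓ, v₁)`. -/
abbrev BasedClosedPath (G : SimpleGraph V) : Type u := Σ v : V, G.Walk v v

/-- Cyclic permutation: the closed path `p · q` is started at the end point of `p` instead. -/
inductive IsRotation (G : SimpleGraph V) : BasedClosedPath G → BasedClosedPath G → Prop
  | mk {u v : V} (p : G.Walk u v) (q : G.Walk v u) :
      IsRotation G ⟨u, p.append q⟩ ⟨v, q.append p⟩

/-- Oriented closed paths in `G`, up to cyclic permutation of their vertices. -/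
def ClosedPath (G : SimpleGraph V) : Type u := Quot (IsRotation G)

namespace ClosedPath

variable {G : SimpleGraph V}

/-- The oriented closed path traced out by a closed walk. -/
def ofWalk {v : V} (p : G.Walk v v) : ClosedPath G := Quot.mk _ ⟨v, p⟩

/-- The number of edges of a closed path. -/
def length : ClosedPath G → ℕ :=
  Quot.lift (fun p => p.2.length) (by
    rintro _ _ ⟨p, q⟩
    simp [SimpleGraph.Walk.length_append, Nat.add_comm])

/-- The same closed path with the opposite orientation. -/
def reverse : ClosedPath G → ClosedPath G :=
  Quot.map (fun p => ⟨p.1, p.2.reverse⟩) (by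
    rintro _ _ ⟨p, q⟩
    simpa [SimpleGraph.Walk.reverse_append] using IsRotation.mk q.reverse p.reverse)

/-- An elementary homotopy inserts a detour `v, v', v` to a neighbour `v'` of a vertex `v`
of the path (the vertex `v` being the end point of `p` below). -/
inductive ElementaryHomotopy : ClosedPath G → ClosedPath G → Prop
  | mk {u v v' : V} (p : G.Walk u v) (q : G.Walk v u) (h : G.Adj v v') :
      ElementaryHomotopy (ofWalk (p.append q))
        (ofWalk (p.append (.cons h (.cons h.symm q))))

/-- Free homotopy: a finite sequence of elementary homotopies and their inverses. -/
def FreelyHomotopic : ClosedPath G → ClosedPath G → Prop :=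
  Relation.EqvGen ElementaryHomotopy

/-- A closed geodesic is a closed path that is shortest in its free homotopy class; the constant
paths (length `0`), which represent the trivial class, are not counted. -/
def IsClosedGeodesic (γ : ClosedPath G) : Prop :=
  0 < γ.length ∧ ∀ γ' : ClosedPath G, FreelyHomotopic γ γ' → γ.length ≤ γ'.length

/-- The closed walk `p` run through `k` times. -/
def walkPow {v : V} (p : G.Walk v v) : ℕ → G.Walk v v
  | 0 => .nil
  | k + 1 => p.append (walkPow p k)

/-- `γ` is a power of `δ`: it runs `k` times through `δ`, from some starting vertex of `δ`. -/
def IsPowerOf (γ δ : ClosedPath G) : Prop :=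
  ∃ (v : V) (p : G.Walk v v) (k : ℕ), δ = ofWalk p ∧ γ = ofWalk (walkPow p k)

/-- A closed geodesic is primitive if it is not a power of a shorter closed geodesic. -/
def IsPrimitiveGeodesic (γ : ClosedPath G) : Prop :=
  IsClosedGeodesic γ ∧
    ¬ ∃ δ : ClosedPath G, IsClosedGeodesic δ ∧ δ.length < γ.length ∧ IsPowerOf γ δ

end ClosedPath

/-- The oriented primitive closed geodesics of length `ℓ` in `G`. -/
def primitiveGeodesics (G : SimpleGraph V) (ℓ : ℕ) : Set (ClosedPath G) :=
  {γ | γ.IsPrimitiveGeodesic ∧ γ.length = ℓ}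

/-- The multiplicity `m_ℓ`: the number of non-oriented primitive closed geodesics of length `ℓ`,
a non-oriented geodesic being an unordered pair `{γ, γ⁻¹}`. -/
def multiplicity (G : SimpleGraph V) (ℓ : ℕ) : ℕ :=
  ((fun γ : ClosedPath G => s(γ, γ.reverse)) '' primitiveGeodesics G ℓ).ncard

/-- The `r`-th term of the power series of the modified Bessel function `I_m` at `z`. -/
def besselITerm (m : ℕ) (z : ℝ) (r : ℕ) : ℝ := (z / 2) ^ (m + 2 * r) / (r ! * (m + r)!)

/-- The modified Bessel function of the first kind `I_m(z)`, of integer order `m ≥ 0`. -/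
def besselI (m : ℕ) (z : ℝ) : ℝ := ∑' r : ℕ, besselITerm m z r

/-- The summand of `F_ℓ(t)` for an index `k`. -/
def FTerm (ℓ : ℕ) (t : ℝ) (k : ℕ) : ℝ :=
  besselI (k * ℓ) (2 * √2 * t) / (2 : ℝ) ^ ((k : ℝ) * (ℓ : ℝ) / 2)

/-- `F_ℓ(t) = ∑_{k ≥ 1} I_{kℓ}(2√2 t) / 2^{kℓ/2}`. -/
def F (ℓ : ℕ) (t : ℝ) : ℝ := ∑' k : {k : ℕ // 1 ≤ k}, FTerm ℓ t k

/-- The integrand of `J(t)`. -/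
def JIntegrand (t s : ℝ) : ℝ := Real.exp (s * t) * (√(8 - s ^ 2) / (9 - s ^ 2))

/-- `J(t)`, the integral of `e^{st}` against the spectral density of the cubic tree. -/
def J (t : ℝ) : ℝ := 3 / (2 * Real.pi) * ∫ s in (-(2 * √2))..(2 * √2), JIntegrand t s

section Spectrum

variable [Fintype V] [DecidableEq V] (G : SimpleGraph V) [DecidableRel G.Adj]

/-- The eigenvalues of the adjacency matrix of `G`, listed with multiplicity. -/
def eigenvalue : V → ℝ := Matrix.IsHermitian.eigenvalues (G.isHermitian_adjMatrix ℝ)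

/-- `(1/n) ∑ e^{tλ_i}`. -/
def expAverage (t : ℝ) : ℝ :=
  1 / (Fintype.card V : ℝ) * ∑ i : V, Real.exp (t * eigenvalue G i)

/-- The mean `μ` of the numbers `e^{λ_i/3}`. -/
def mean : ℝ := 1 / (Fintype.card V : ℝ) * ∑ i : V, Real.exp (eigenvalue G i / 3)

/-- The variance `σ` of the numbers `e^{λ_i/3}` (with the normalization `1/n`). -/
def variance : ℝ :=
  1 / (Fintype.card V : ℝ) * ∑ i : V, (Real.exp (eigenvalue G i / 3) - mean G) ^ 2

end Spectrum

end CubicTrace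

end

/-!
Let `c` run through the nonbacktracking bi-infinite sequences of vertices, and let `N m` be the
number of those of period `m`. It is the trace of the `m`-th power of the nonbacktracking matrix on
darts, and a Chebyshev-type recursion evaluates it as `tr (D m (A)) + n * [m even]`, where `A` is
the adjacency matrix and `D m` the Dickson polynomial with `D m (α + β) = α ^ m + β ^ m` whenever
`α * β = 2`. Weighting by `I_m(2√2 t) / 2^{m/2}` and summing over `m`, the generating function
`e^{x (z + 1/z) / 2} = ∑ I_m(x) z^m` of the Bessel functions turns the traces into `∑ e^{t λ_i}`,
while the weights of even index sum to `J t` up to `I_0` terms, which cancel the contribution of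
`m = 0`. Hence the weighted sum of the `N m` with `m ≥ 1` is `∑ e^{t λ_i} - n * J t`.

The same sequences encode closed geodesics. Reading a closed path as a word in its darts, a dart
and its reverse being inverse letters, sends free homotopies to conjugations in a free group, and a
cyclically reduced word is shortest in its conjugacy class; so the closed geodesics are the closed
paths without backtracking, that is, the periodic nonbacktracking sequences up to shift. Such a
geodesic is primitive when its length is the minimal period, and it is never a shift of its own
reversal. Sorting by minimal period gives `N m = ∑_{l ∣ m} 2 * l * m_l`, and rearranging the
weighted sum of the `N m` as a double sum over `l` and `m / l` is the trace formula.
-/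

namespace CubicTrace

/-! ### Bessel functions and Dickson polynomials -/

theorem abs_besselITerm (m : ℕ) (x : ℝ) (r : ℕ) : |besselITerm m x r| = besselITerm m |x| r := by
  simp only [besselITerm, abs_div, abs_pow, abs_mul, abs_two, Nat.abs_cast]

/-- A pair of naturals, recorded as its difference and its minimum. -/
def differenceMinEquiv : ℤ × ℕ ≃ ℕ × ℕ where
  toFun p := (p.1.toNat + p.2, (-p.1).toNat + p.2)
  invFun p := (p.1 - p.2, min p.1 p.2)
  left_inv p := by ext <;> grind
  right_inv p := by ext <;> grind

/-- The terms of the product of the exponential series of `x z / 2` and of `x z⁻¹ / 2`. -/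
noncomputable def expProductTerm (x : ℝ) (z : ℂ) (p : ℕ × ℕ) : ℂ :=
  (x / 2 * z) ^ p.1 / p.1 ! * ((x / 2 * z⁻¹) ^ p.2 / p.2 !)

theorem hasSum_expProductTerm (x : ℝ) (z : ℂ) :
    HasSum (expProductTerm x z) (Complex.exp (x / 2 * (z + z⁻¹))) := by
  let expTerm (w : ℂ) (n : ℕ) : ℂ := w ^ n / (n !)
  have hexp (w : ℂ) : HasSum (expTerm w) (Complex.exp w) := by
    rw [Complex.exp_eq_exp_ℂ]
    exact NormedSpace.expSeries_div_hasSum_exp w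
  have hnorm (w : ℂ) : Summable fun n : ℕ => ‖expTerm w n‖ :=
    NormedSpace.norm_expSeries_div_summable w
  rw [mul_add, Complex.exp_add]
  exact HasSum.mul (f := expTerm (x / 2 * z)) (g := expTerm (x / 2 * z⁻¹)) (hexp _) (hexp _)
    (summable_mul_of_summable_norm (hnorm _) (hnorm _))

theorem expProductTerm_differenceMinEquiv (x : ℝ) {z : ℂ} (hz : z ≠ 0) (k : ℤ) (r : ℕ) :
    expProductTerm x z (differenceMinEquiv (k, r)) = besselITerm k.natAbs x r * z ^ k := by
  obtain ⟨n, rfl | rfl⟩ := k.eq_nat_or_neg <;>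
  · simp only [expProductTerm, besselITerm, differenceMinEquiv, Equiv.coe_fn_mk, Int.toNat_natCast,
      Int.toNat_neg_natCast, neg_neg, Int.natAbs_natCast, Int.natAbs_neg, zpow_neg, zpow_natCast,
      zero_add, mul_pow, inv_pow, pow_add]
    push_cast
    field_simp
    ring

theorem summable_besselITerm (m : ℕ) (x : ℝ) : Summable (besselITerm m x) := by
  have h := (differenceMinEquiv.summable_iff.mpr (hasSum_expProductTerm x 1).summable).prod_factor
    (m : ℤ)
  simp only [Function.comp, expProductTerm_differenceMinEquiv x one_ne_zero, Int.natAbs_natCast,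
    one_zpow, mul_one] at h
  exact Complex.summable_ofReal.mp h

theorem abs_besselI_le (m : ℕ) (x : ℝ) : |besselI m x| ≤ besselI m |x| := by
  have h := norm_tsum_le_tsum_norm (summable_besselITerm m x).norm
  simpa only [besselI, Real.norm_eq_abs, abs_besselITerm] using h

theorem hasSum_besselI_mul_zpow (x : ℝ) {z : ℂ} (hz : z ≠ 0) :
    HasSum (fun k : ℤ => besselI k.natAbs x * z ^ k) (Complex.exp (x / 2 * (z + z⁻¹))) := by
  refine (differenceMinEquiv.hasSum_iff.mpr (hasSum_expProductTerm x z)).prod_fiberwise fun k => ?_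
  simp only [Function.comp, expProductTerm_differenceMinEquiv x hz]
  exact (Complex.hasSum_ofReal.mpr (summable_besselITerm k.natAbs x).hasSum).mul_right _

theorem summable_abs_besselI_mul_pow (x : ℝ) {y : ℝ} (hy : 0 ≤ y) :
    Summable fun m : ℕ => |besselI m x| * y ^ m := by
  have hy1 : ((y + 1 : ℝ) : ℂ) ≠ 0 := mod_cast (by positivity : y + 1 ≠ 0)
  have h : Summable fun m : ℕ => besselI m |x| * (y + 1) ^ m := by
    refine Complex.summable_ofReal.mp
      (((hasSum_besselI_mul_zpow |x| hy1).summable.comp_injective Nat.cast_injective).congr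
        fun m => ?_)
    simp
  refine h.of_nonneg_of_le (fun m => by positivity) fun m => ?_
  have hbound := abs_besselI_le m x
  gcongr
  · exact (abs_nonneg _).trans hbound
  · linarith

theorem hasSum_besselI_mul_pow_add_pow (x : ℝ) {z : ℂ} (hz : z ≠ 0) :
    HasSum (fun m : ℕ => besselI m x * (z ^ m + z⁻¹ ^ m))
      (Complex.exp (x / 2 * (z + z⁻¹)) + besselI 0 x) := by
  convert (hasSum_besselI_mul_zpow x hz).nat_add_neg using 2 with m
  · simp [mul_add]
  · simp

theorem eval_dickson_add {R : Type*} [CommRing R] (α β : R) (m : ℕ) :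
    (Polynomial.dickson 1 (α * β) m).eval (α + β) = α ^ m + β ^ m := by
  induction m using Nat.twoStepInduction with
  | zero => simp only [Polynomial.dickson_zero, Polynomial.eval_sub, Polynomial.eval_ofNat,
      Nat.cast_one, Polynomial.eval_one, pow_zero]; norm_num
  | one => simp
  | more m ih ih' =>
    simp only [Polynomial.dickson_add_two, Polynomial.eval_sub, Polynomial.eval_mul,
      Polynomial.eval_X, Polynomial.eval_C, ih, ih']
    ring

theorem exists_add_eq_mul_eq {K : Type*} [Field K] [IsAlgClosed K] (l a : K) :
    ∃ α β : K, α + β = l ∧ α * β = a := by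
  obtain ⟨α, hα⟩ := IsAlgClosed.exists_root
    (Polynomial.X ^ 2 - Polynomial.C l * Polynomial.X + Polynomial.C a) <| by
      have : (Polynomial.X ^ 2 - Polynomial.C l * Polynomial.X + Polynomial.C a).degree = 2 := by
        compute_degree!
      simp [this]
  simp only [Polynomial.IsRoot, Polynomial.eval_add, Polynomial.eval_sub, Polynomial.eval_pow,
    Polynomial.eval_mul, Polynomial.eval_X, Polynomial.eval_C] at hα
  exact ⟨α, l - α, by ring, by linear_combination -hα⟩

theorem hasSum_besselI_mul_dickson {a : ℝ} (ha : 0 < a) (t l : ℝ) :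
    HasSum (fun m : ℕ => besselI m (2 * √a * t) / √a ^ m * (Polynomial.dickson 1 a m).eval l)
      (Real.exp (t * l) + besselI 0 (2 * √a * t)) := by
  obtain ⟨α, β, hl, hα⟩ := exists_add_eq_mul_eq (l : ℂ) (a : ℂ)
  have hs : (√a : ℂ) ^ 2 = a := mod_cast Real.sq_sqrt ha.le
  have hs0 : (√a : ℂ) ≠ 0 := mod_cast (Real.sqrt_pos.mpr ha).ne'
  have hα0 : α ≠ 0 := left_ne_zero_of_mul (hα.trans_ne (mod_cast ha.ne'))
  have hinv : (α / √a : ℂ)⁻¹ = β / √a := by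
    rw [inv_div, div_eq_div_iff hα0 hs0, ← sq, hs, mul_comm, hα]
  have hdickson (m : ℕ) :
      (((Polynomial.dickson 1 a m).eval l : ℝ) : ℂ) = α ^ m + β ^ m := by
    rw [← eval_dickson_add, hl, hα, ← Complex.ofRealHom_eq_coe, ← Complex.ofRealHom_eq_coe,
      ← Complex.ofRealHom_eq_coe, ← Polynomial.map_dickson, Polynomial.eval_map_apply]
  refine Complex.hasSum_ofReal.mp ?_
  convert hasSum_besselI_mul_pow_add_pow (2 * √a * t) (div_ne_zero hα0 hs0) using 1
  · funext m
    push_cast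
    rw [hdickson, hinv, div_pow, div_pow]
    ring
  · push_cast
    congr 2
    rw [hinv, ← hl]
    field_simp

theorem hasSum_besselI_mul_cos (x θ : ℝ) :
    HasSum (fun k : ℤ => besselI k.natAbs x * Real.cos (k * θ)) (Real.exp (x * Real.cos θ)) := by
  have h := Complex.reCLM.hasSum
    (hasSum_besselI_mul_zpow x (Complex.exp_ne_zero (θ * Complex.I)))
  convert h using 1
  · funext k
    rw [← Complex.exp_int_mul, Complex.reCLM_apply, Complex.re_ofReal_mul, ← mul_assoc]
    exact_mod_cast congrArg _ (Complex.exp_ofReal_mul_I_re _).symm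
  · rw [← Complex.exp_neg, ← neg_mul, ← Complex.two_cos, Complex.reCLM_apply]
    rw [show (x / 2 * (2 * Complex.cos θ) : ℂ) = ((x * Real.cos θ : ℝ) : ℂ) by push_cast; ring,
      Complex.exp_ofReal_re]

/-! ### The spectral density of the cubic tree -/

theorem hasSum_integral_mul_cos {ι : Type*} [Countable ι] {c : ι → ℝ}
    (hc : Summable fun i => |c i|) (ν : ι → ℝ) {f g : ℝ → ℝ} (hf : Continuous f)
    (hg : ∀ θ, HasSum (fun i => c i * Real.cos (ν i * θ)) (g θ)) (a b : ℝ) :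
    HasSum (fun i => c i * ∫ θ in a..b, f θ * Real.cos (ν i * θ)) (∫ θ in a..b, f θ * g θ) := by
  simp only [← intervalIntegral.integral_const_mul]
  refine intervalIntegral.hasSum_integral_of_dominated_convergence (fun i θ => |c i| * |f θ|)
    (fun i => Continuous.aestronglyMeasurable (by fun_prop))
    (fun i => .of_forall fun θ _ => ?_) (.of_forall fun θ _ => hc.mul_right _)
    ?_ (.of_forall fun θ _ => by simpa only [mul_left_comm] using (hg θ).mul_left (f θ))
  · rw [Real.norm_eq_abs, abs_mul, abs_mul]
    gcongr
    exact mul_le_of_le_one_right (abs_nonneg _) (Real.abs_cos_le_one _)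
  · simp only [tsum_mul_right]
    exact Continuous.intervalIntegrable (by fun_prop) _ _

theorem integral_cos_int_mul (n : ℤ) :
    ∫ θ in (0 : ℝ)..Real.pi, Real.cos (n * θ) = if n = 0 then Real.pi else 0 := by
  split_ifs with hn
  · simp [hn]
  · rw [intervalIntegral.integral_comp_mul_left Real.cos (Int.cast_ne_zero.mpr hn)]
    simp [integral_cos, Real.sin_int_mul_pi]

theorem integral_cos_int_mul_mul_cos_int_mul (m k : ℤ) :
    ∫ θ in (0 : ℝ)..Real.pi, Real.cos (m * θ) * Real.cos (k * θ) =
      Real.pi / 2 * ((if k = m then 1 else 0) + if k = -m then 1 else 0) := by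
  have hcos (θ : ℝ) : Real.cos (m * θ) * Real.cos (k * θ) =
      (Real.cos ((m - k : ℤ) * θ) + Real.cos ((m + k : ℤ) * θ)) / 2 := by
    push_cast
    rw [sub_mul, add_mul, ← Real.two_mul_cos_mul_cos]
    ring
  have hcont (n : ℤ) : IntervalIntegrable (fun θ : ℝ => Real.cos (n * θ))
      MeasureTheory.volume 0 Real.pi := Continuous.intervalIntegrable (by fun_prop) _ _
  simp only [hcos, intervalIntegral.integral_div]
  rw [intervalIntegral.integral_add (hcont _) (hcont _), integral_cos_int_mul,
    integral_cos_int_mul]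
  simp only [sub_eq_zero, add_eq_zero_iff_eq_neg', eq_comm (a := m)]
  split_ifs <;> ring

theorem integral_exp_mul_cos_mul_cos (x : ℝ) (m : ℕ) :
    ∫ θ in (0 : ℝ)..Real.pi, Real.exp (x * Real.cos θ) * Real.cos (m * θ) =
      Real.pi * besselI m x := by
  have hsum : Summable fun k : ℤ => |besselI k.natAbs x| := by
    have h : Summable fun m : ℕ => |besselI m x| := by
      simpa using summable_abs_besselI_mul_pow x zero_le_one
    exact Summable.of_nat_of_neg (by simpa using h) (by simpa using h)
  have h := hasSum_integral_mul_cos hsum (fun k => k)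
    (f := fun θ => Real.cos ((m : ℤ) * θ)) (by fun_prop) (hasSum_besselI_mul_cos x) 0 Real.pi
  simp only [integral_cos_int_mul_mul_cos_int_mul, mul_left_comm _ (Real.pi / 2)] at h
  have hm (n : ℤ) : HasSum (fun k : ℤ => besselI k.natAbs x * if k = n then 1 else 0)
      (besselI n.natAbs x) := by
    convert hasSum_ite_eq n (besselI n.natAbs x) using 2 with k
    split_ifs with hk <;> simp [hk]
  have h' := ((hm m).add (hm (-m))).mul_left (Real.pi / 2)
  simp only [← mul_add, Int.natAbs_neg, Int.natAbs_natCast] at h'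
  simp only [mul_comm (Real.exp _)]
  refine (h.unique h').trans ?_
  ring

theorem hasSum_pow_mul_cos {r : ℝ} (hr : |r| < 1) (θ : ℝ) :
    HasSum (fun j : ℕ => r ^ j * Real.cos (j * θ))
      ((1 - r * Real.cos θ) / (1 - 2 * r * Real.cos θ + r ^ 2)) := by
  have hnorm : ‖r * Complex.exp (θ * Complex.I)‖ < 1 := by
    rwa [norm_mul, Complex.norm_exp_ofReal_mul_I, mul_one, Complex.norm_real]
  convert Complex.hasSum_re (hasSum_geometric_of_norm_lt_one hnorm) using 1
  · funext j
    rw [mul_pow, ← Complex.exp_nat_mul, ← mul_assoc, ← Complex.ofReal_pow, Complex.re_ofReal_mul]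
    exact_mod_cast congrArg _ (Complex.exp_ofReal_mul_I_re _).symm
  · simp only [Complex.inv_re, Complex.normSq_apply, Complex.sub_re, Complex.sub_im,
      Complex.one_re, Complex.one_im, Complex.re_ofReal_mul, Complex.im_ofReal_mul,
      Complex.exp_ofReal_mul_I_re, Complex.exp_ofReal_mul_I_im]
    congr 1
    linear_combination -r ^ 2 * Real.sin_sq_add_cos_sq θ

theorem nine_sub_eight_mul_cos_sq_pos (θ : ℝ) : 0 < 9 - 8 * Real.cos θ ^ 2 := by
  linarith [Real.cos_sq_le_one θ]

theorem hasSum_half_pow_mul_cos (θ : ℝ) :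
    HasSum (fun j : ℕ => (1 / 2 : ℝ) ^ j * Real.cos ((2 * j : ℕ) * θ))
      (2 - 12 * Real.sin θ ^ 2 / (9 - 8 * Real.cos θ ^ 2)) := by
  convert hasSum_pow_mul_cos (r := 1 / 2) (by norm_num [abs_of_pos]) (2 * θ) using 1
  · funext j
    push_cast
    ring_nf
  · have h := (nine_sub_eight_mul_cos_sq_pos θ).ne'
    rw [Real.cos_two_mul, Real.sin_sq,
      show 1 - 2 * (1 / 2) * (2 * Real.cos θ ^ 2 - 1) + (1 / 2) ^ 2 =
        (9 - 8 * Real.cos θ ^ 2) / 4 by ring, div_div_eq_mul_div, eq_div_iff h, sub_mul,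
      div_mul_cancel₀ _ h]
    ring

theorem continuousOn_JIntegrand (t : ℝ) :
    ContinuousOn (JIntegrand t) (Set.Icc (-(2 * √2)) (2 * √2)) := by
  refine ContinuousOn.mul (by fun_prop) (ContinuousOn.div (by fun_prop) (by fun_prop) ?_)
  intro s hs
  have hs8 : s ^ 2 ≤ (2 * √2) ^ 2 := sq_le_sq' hs.1 hs.2
  rw [mul_pow, Real.sq_sqrt zero_le_two] at hs8
  linarith

theorem intervalIntegrable_JIntegrand (t : ℝ) :
    IntervalIntegrable (JIntegrand t) MeasureTheory.volume (-(2 * √2)) (2 * √2) := by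
  refine ContinuousOn.intervalIntegrable ?_
  rw [Set.uIcc_of_le (neg_le_self (by positivity))]
  exact continuousOn_JIntegrand t

theorem JIntegrand_two_sqrt_two_mul_cos (t : ℝ) {θ : ℝ} (hθ : 0 ≤ Real.sin θ) :
    JIntegrand t (2 * √2 * Real.cos θ) = Real.exp (2 * √2 * t * Real.cos θ) *
      (2 * √2 * Real.sin θ / (9 - 8 * Real.cos θ ^ 2)) := by
  have hsq (y : ℝ) : (2 * √2 * y) ^ 2 = 8 * y ^ 2 := by
    rw [mul_pow, mul_pow, Real.sq_sqrt zero_le_two]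
    ring
  have hsin : 8 - 8 * Real.cos θ ^ 2 = (2 * √2 * Real.sin θ) ^ 2 := by
    rw [hsq, Real.sin_sq]
    ring
  rw [JIntegrand, hsq, hsin, Real.sqrt_sq (by positivity), mul_right_comm]

theorem J_eq_integral (t : ℝ) :
    J t = 1 / Real.pi * ∫ θ in (0 : ℝ)..Real.pi, Real.exp (2 * √2 * t * Real.cos θ) *
      (12 * Real.sin θ ^ 2 / (9 - 8 * Real.cos θ ^ 2)) := by
  have hmaps : (fun θ => 2 * √2 * Real.cos θ) '' Set.uIcc Real.pi 0 ⊆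
      Set.Icc (-(2 * √2)) (2 * √2) := by
    rintro _ ⟨θ, -, rfl⟩
    constructor <;> nlinarith [Real.neg_one_le_cos θ, Real.cos_le_one θ, Real.sqrt_nonneg 2]
  have hsubst := intervalIntegral.integral_comp_mul_deriv'' (a := Real.pi) (b := 0)
    (f := fun θ => 2 * √2 * Real.cos θ) (f' := fun θ => 2 * √2 * -Real.sin θ)
    (g := JIntegrand t) (by fun_prop)
    (fun θ _ => ((Real.hasDerivAt_cos θ).const_mul _).hasDerivWithinAt) (by fun_prop)
    ((continuousOn_JIntegrand t).mono hmaps)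
  simp only [Real.cos_pi, Real.cos_zero, mul_neg, mul_one] at hsubst
  rw [J, ← hsubst, intervalIntegral.integral_symm, ← intervalIntegral.integral_neg,
    ← intervalIntegral.integral_const_mul, ← intervalIntegral.integral_const_mul]
  refine intervalIntegral.integral_congr fun θ hθ => ?_
  rw [Set.uIcc_of_le Real.pi_pos.le] at hθ
  have hsq : √2 ^ 2 = (2 : ℝ) := Real.sq_sqrt zero_le_two
  simp only [Function.comp, JIntegrand_two_sqrt_two_mul_cos t (Real.sin_nonneg_of_mem_Icc hθ)]
  linear_combination (6 * Real.sin θ ^ 2 / Real.pi * Real.exp (2 * √2 * t * Real.cos θ) /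
    (9 - 8 * Real.cos θ ^ 2)) * hsq

theorem hasSum_besselI_two_mul_div_two_pow (t : ℝ) :
    HasSum (fun j : ℕ => besselI (2 * j) (2 * √2 * t) / 2 ^ j)
      (2 * besselI 0 (2 * √2 * t) - J t) := by
  have h := (hasSum_integral_mul_cos (summable_geometric_two.abs) (fun j => (2 * j : ℕ))
    (f := fun θ => Real.exp (2 * √2 * t * Real.cos θ)) (by fun_prop)
    hasSum_half_pow_mul_cos 0 Real.pi).mul_left (1 / Real.pi)
  have hcont : Continuous fun θ : ℝ => 12 * Real.sin θ ^ 2 / (9 - 8 * Real.cos θ ^ 2) :=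
    Continuous.div (by fun_prop) (by fun_prop) fun θ => (nine_sub_eight_mul_cos_sq_pos θ).ne'
  have h0 := integral_exp_mul_cos_mul_cos (2 * √2 * t) 0
  simp only [Nat.cast_zero, zero_mul, Real.cos_zero, mul_one] at h0
  simp only [integral_exp_mul_cos_mul_cos, mul_sub] at h
  rw [intervalIntegral.integral_sub (Continuous.intervalIntegrable (by fun_prop) _ _)
    (Continuous.intervalIntegrable (by fun_prop) _ _), intervalIntegral.integral_mul_const, h0,
    mul_sub, ← J_eq_integral] at h
  rw [show 2 * besselI 0 (2 * √2 * t) - J t =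
    1 / Real.pi * (Real.pi * besselI 0 (2 * √2 * t) * 2) - J t by field_simp]
  refine h.congr_fun fun j => ?_
  rw [one_div_pow]
  field_simp

/-! ### Traces of powers of the nonbacktracking matrix -/

section NonbacktrackingAlgebra

open Matrix

theorem aeval_dickson_zero {R A : Type*} [CommRing R] [Ring A] [Algebra R A] (a : R) (x : A) :
    Polynomial.aeval x (Polynomial.dickson 1 a 0) = (2 : R) • 1 := by
  have h : Polynomial.dickson 1 a 0 = Polynomial.C 2 := by
    rw [Polynomial.dickson_zero, map_ofNat]
    norm_num
  rw [h, Polynomial.aeval_C, Algebra.algebraMap_eq_smul_one]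

theorem aeval_dickson_add_two {R A : Type*} [CommRing R] [Ring A] [Algebra R A] (a : R) (x : A)
    (m : ℕ) :
    Polynomial.aeval x (Polynomial.dickson 1 a (m + 2)) =
      x * Polynomial.aeval x (Polynomial.dickson 1 a (m + 1)) -
        a • Polynomial.aeval x (Polynomial.dickson 1 a m) := by
  simp [Polynomial.dickson_add_two, Algebra.smul_def]

variable {R V D : Type*} [CommRing R] [Fintype V] [Fintype D] [DecidableEq D]
  {S : Matrix V D R} {T : Matrix D V R} {J : Matrix D D R} {q : R}

theorem trace_mul_nonbacktracking_pow_mul (k : ℕ) :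
    trace (S * (T * S - J) ^ k * T) =
      trace ((T * S - J) ^ (k + 1)) + trace ((T * S - J) ^ k * J) := by
  rw [Matrix.mul_assoc, trace_mul_comm, Matrix.mul_assoc, ← trace_add, pow_succ, ← mul_add,
    sub_add_cancel]

variable [DecidableEq V]

theorem mul_involution_mul_nonbacktracking (hJ : J * J = 1) (hSJT : S * J * T = (q + 1) • 1) :
    (T * S - J) * J * (T * S - J) = (q - 1) • (T * S - J) + q • J := by
  have hTSJTS : T * S * J * (T * S) = (q + 1) • (T * S) := by
    calc T * S * J * (T * S) = T * (S * J * T) * S := by simp only [Matrix.mul_assoc]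
      _ = (q + 1) • (T * S) := by
        rw [hSJT, Matrix.mul_smul, Matrix.mul_one, Matrix.smul_mul]
  rw [sub_mul, sub_mul, mul_sub, mul_sub, hTSJTS, Matrix.mul_assoc _ J J, hJ, Matrix.mul_one,
    one_mul, one_mul]
  module

theorem trace_nonbacktracking_pow_mul_involution (hJ : J * J = 1)
    (hSJT : S * J * T = (q + 1) • 1) (k : ℕ) :
    trace ((T * S - J) ^ (k + 2) * J) =
      (q - 1) * trace ((T * S - J) ^ (k + 1)) + q * trace ((T * S - J) ^ k * J) := by
  have hBJB := mul_involution_mul_nonbacktracking hJ hSJT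
  set B := T * S - J
  calc trace (B ^ (k + 2) * J) = trace (B * (B ^ k * (B * J))) := by
        rw [pow_succ, pow_succ']
        simp only [Matrix.mul_assoc]
    _ = trace (B ^ k * (B * J * B)) := by
        rw [trace_mul_comm]
        simp only [Matrix.mul_assoc]
    _ = _ := by
        rw [hBJB, mul_add, Matrix.mul_smul, Matrix.mul_smul, ← pow_succ, trace_add, trace_smul,
          trace_smul, smul_eq_mul, smul_eq_mul]

theorem mul_mul_nonbacktracking_pow_mul (hJ : J * J = 1) (hSJT : S * J * T = (q + 1) • 1)
    (k : ℕ) :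
    S * T * (S * (T * S - J) ^ (k + 1) * T) =
      S * (T * S - J) ^ (k + 2) * T + q • (S * (T * S - J) ^ k * T) := by
  have hSJB : S * J * (T * S - J) = q • S := by
    rw [Matrix.mul_sub, ← Matrix.mul_assoc, hSJT, Matrix.mul_assoc S J J, hJ, Matrix.mul_one,
      Matrix.smul_mul, Matrix.one_mul]
    module
  have hTS : T * S = (T * S - J) + J := (sub_add_cancel _ _).symm
  generalize T * S - J = B at *
  calc S * T * (S * B ^ (k + 1) * T) = S * (T * S) * B ^ (k + 1) * T := by
        simp only [Matrix.mul_assoc]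
    _ = S * B ^ (k + 2) * T + S * J * B * B ^ k * T := by
        rw [hTS, Matrix.mul_add, Matrix.add_mul, Matrix.add_mul, Matrix.mul_assoc S B,
          ← pow_succ', pow_succ' B k]
        simp only [Matrix.mul_assoc]
    _ = _ := by rw [hSJB, Matrix.smul_mul, Matrix.smul_mul]

theorem mul_nonbacktracking_pow_mul_sub_eq_dickson_sub (hJ : J * J = 1)
    (hSJT : S * J * T = (q + 1) • 1) (k : ℕ) :
    S * (T * S - J) ^ (k + 2) * T - q • (S * (T * S - J) ^ k * T) =
      Polynomial.aeval (S * T) (Polynomial.dickson 1 q (k + 3)) -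
        Polynomial.aeval (S * T) (Polynomial.dickson 1 q (k + 1)) := by
  let C (k : ℕ) := S * (T * S - J) ^ k * T
  have hC0 : C 0 = S * T := by simp [C]
  have hC1 : C 1 = S * T * (S * T) - (q + 1) • 1 := by
    rw [← hSJT]
    simp only [C, pow_one, Matrix.mul_sub, Matrix.sub_mul, Matrix.mul_assoc]
  have hC (k : ℕ) : C (k + 2) = S * T * C (k + 1) - q • C k :=
    eq_sub_of_add_eq (mul_mul_nonbacktracking_pow_mul hJ hSJT k).symm
  change C (k + 2) - q • C k = _
  induction k using Nat.twoStepInduction with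
  | zero =>
    simp only [hC, hC0, hC1, aeval_dickson_add_two, aeval_dickson_zero, zero_add,
      Polynomial.dickson_one, Polynomial.aeval_X, mul_sub, Matrix.mul_smul, mul_one]
    module
  | one =>
    simp only [hC, hC0, hC1, aeval_dickson_add_two, aeval_dickson_zero, zero_add,
      Polynomial.dickson_one, Polynomial.aeval_X, mul_sub, Matrix.mul_smul, mul_one]
    module
  | more k ih ih' =>
    have h := congrArg (S * T * ·) ih'
    simp only [mul_sub, Matrix.mul_smul] at h
    calc C (k + 4) - q • C (k + 2)
        = (S * T * C (k + 3) - q • (S * T * C (k + 1))) - q • (C (k + 2) - q • C k) := by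
          rw [hC (k + 2), hC k]
          module
      _ = _ := by
          rw [h, ih, aeval_dickson_add_two q _ (k + 3), aeval_dickson_add_two q _ (k + 1)]
          module

theorem trace_nonbacktracking_pow (hJ : J * J = 1) (hSJT : S * J * T = (q + 1) • 1)
    (htrJ : trace J = 0) (htr : trace (S * T) = 0)
    (htr2 : trace (S * T * (S * T)) = (q + 1) * Fintype.card V)
    (hcard : (Fintype.card D : R) = (q + 1) * Fintype.card V) (m : ℕ) :
    trace ((T * S - J) ^ (m + 1)) =
      trace (Polynomial.aeval (S * T) (Polynomial.dickson 1 q (m + 1))) +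
        if Even (m + 1) then (q - 1) * (Fintype.card V : R) else 0 := by
  have htr1 : trace ((q + 1) • (1 : Matrix V V R)) = (q + 1) * Fintype.card V := by
    rw [trace_smul, trace_one, smul_eq_mul]
  induction m using Nat.twoStepInduction with
  | zero => simp [htrJ, htr, trace_mul_comm T S]
  | one =>
    have hC : trace (S * (T * S - J) ^ 1 * T) = 0 := by
      rw [pow_one, Matrix.mul_sub, Matrix.sub_mul, hSJT, trace_sub, htr1, ← Matrix.mul_assoc,
        Matrix.mul_assoc (S * T), htr2, sub_self]
    have hBJ : trace ((T * S - J) ^ 1 * J) = 0 := by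
      rw [pow_one, Matrix.sub_mul, hJ, trace_sub, Matrix.mul_assoc, trace_mul_comm, hSJT, htr1,
        trace_one, hcard, sub_self]
    have hB := trace_mul_nonbacktracking_pow_mul (S := S) (T := T) (J := J) 1
    rw [hC, hBJ, add_zero] at hB
    rw [← hB, if_pos (by decide), aeval_dickson_add_two, aeval_dickson_zero, trace_sub, trace_smul,
      trace_smul, trace_one, zero_add, Polynomial.dickson_one, Polynomial.aeval_X, htr2,
      smul_eq_mul, smul_eq_mul]
    ring
  | more k ih _ =>
    have h := congrArg trace (mul_nonbacktracking_pow_mul_sub_eq_dickson_sub hJ hSJT k)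
    rw [trace_sub, trace_sub, trace_smul, trace_mul_nonbacktracking_pow_mul,
      trace_mul_nonbacktracking_pow_mul, trace_nonbacktracking_pow_mul_involution hJ hSJT, ih,
      smul_eq_mul] at h
    have heven : Even (k + 2 + 1) ↔ Even (k + 1) := by grind
    simp only [heven]
    linear_combination h

theorem trace_aeval_eq_sum_eigenvalues {𝕜 n : Type*} [RCLike 𝕜] [Fintype n] [DecidableEq n]
    {A : Matrix n n 𝕜} (hA : A.IsHermitian) (p : Polynomial 𝕜) :
    trace (Polynomial.aeval A p) = ∑ i, p.eval (hA.eigenvalues i : 𝕜) := by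
  conv_lhs => rw [hA.spectral_theorem]
  rw [Polynomial.aeval_algHom_apply, Unitary.conjStarAlgAut_apply, trace_mul_comm, ← mul_assoc,
    Unitary.coe_star_mul_self, one_mul, ← Matrix.diagonalAlgHom_apply (R := 𝕜),
    Polynomial.aeval_algHom_apply, Matrix.diagonalAlgHom_apply, trace_diagonal,
    Polynomial.aeval_pi_apply]
  rfl

end NonbacktrackingAlgebra

/-! ### Periodic sequences and traces -/

section PeriodicSequences

theorem periodic_apply_emod {α : Type*} {f : ℤ → α} {n : ℤ} (hf : Function.Periodic f n) (i : ℤ) :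
    f (i % n) = f i := by
  simpa [Int.emod_def, mul_comm] using hf.sub_int_mul_eq (x := i) (i / n)

theorem image_comp_intCast_eq_setOf_periodic {α : Type*} (m : ℕ) (R : α → α → Prop) :
    (fun (g : ZMod m → α) (i : ℤ) => g i) '' {g | ∀ x, R (g x) (g (x + 1))} =
      {f : ℤ → α | (∀ i, R (f i) (f (i + 1))) ∧ Function.Periodic f m} := by
  ext f
  constructor
  · rintro ⟨g, hg, rfl⟩
    exact ⟨fun i => by simpa using hg i, fun i => by simp⟩
  · rintro ⟨hR, hf⟩
    have hcast (i : ℤ) : f ((i : ZMod m).cast) = f i := by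
      rw [ZMod.coe_intCast, periodic_apply_emod hf]
    refine ⟨fun x => f x.cast, fun x => ?_, funext hcast⟩
    obtain ⟨i, rfl⟩ := ZMod.intCast_surjective x
    have h := hcast (i + 1)
    push_cast at h
    simp only [h, hcast, hR]

theorem injective_comp_intCast {α : Type*} (m : ℕ) :
    Function.Injective fun (g : ZMod m → α) (i : ℤ) => g i :=
  ZMod.intCast_surjective.injective_comp_right

theorem image_comp_intCast_univ {α : Type*} (m : ℕ) :
    (fun (g : ZMod m → α) (i : ℤ) => g i) '' Set.univ = {f : ℤ → α | Function.Periodic f m} := by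
  simpa using image_comp_intCast_eq_setOf_periodic m fun _ _ : α => True

theorem finite_setOf_periodic (α : Type*) [Finite α] (m : ℕ) [NeZero m] :
    {f : ℤ → α | Function.Periodic f m}.Finite :=
  image_comp_intCast_univ (α := α) m ▸ Set.toFinite _

theorem ncard_setOf_periodic (α : Type*) (m : ℕ) [NeZero m] :
    {f : ℤ → α | Function.Periodic f m}.ncard = Nat.card α ^ m := by
  rw [← image_comp_intCast_univ, Set.ncard_image_of_injective _ (injective_comp_intCast m),
    Set.ncard_univ, Nat.card_fun, Nat.card_zmod]

open Matrix

variable {R n : Type*} [CommSemiring R] [Fintype n] [DecidableEq n]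

theorem pow_succ_apply_eq_sum_prod (M : Matrix n n R) (m : ℕ) (a b : n) :
    (M ^ (m + 1)) a b = ∑ f : Fin m → n, ∏ i : Fin (m + 1),
      M (Fin.cons (α := fun _ => n) a f i) (Fin.snoc (α := fun _ => n) f b i) := by
  induction m generalizing a with
  | zero => simp [Fin.snoc]
  | succ m ih =>
    rw [pow_succ', Matrix.mul_apply, ← (Fin.consEquiv fun _ => n).sum_comp, Fintype.sum_prod_type]
    refine Finset.sum_congr rfl fun x _ => ?_
    rw [ih, Finset.mul_sum]
    refine Finset.sum_congr rfl fun f _ => ?_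
    rw [Fin.prod_univ_succ (n := m + 1)]
    simp only [show Fin.consEquiv (fun _ => n) (x, f) = Fin.cons x f from rfl,
      ← Fin.cons_snoc_eq_snoc_cons, Fin.cons_zero, Fin.cons_succ]

theorem trace_pow_eq_sum_prod (M : Matrix n n R) (m : ℕ) [NeZero m] :
    trace (M ^ m) = ∑ f : ZMod m → n, ∏ i, M (f i) (f (i + 1)) := by
  obtain ⟨m, rfl⟩ := Nat.exists_eq_succ_of_ne_zero (NeZero.ne m)
  change trace (M ^ (m + 1)) = ∑ f : Fin (m + 1) → n, ∏ i, M (f i) (f (i + 1))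
  rw [trace, ← (Fin.consEquiv fun _ => n).sum_comp, Fintype.sum_prod_type]
  refine Finset.sum_congr rfl fun a _ => ?_
  rw [Matrix.diag_apply, pow_succ_apply_eq_sum_prod]
  simp only [Fin.snoc_eq_cons_rotate, finRotate_apply, Fin.consEquiv_apply]

theorem trace_pow_eq_ncard_periodic {r : n → n → Prop} [DecidableRel r] {M : Matrix n n R}
    (hM : ∀ a b, M a b = if r a b then 1 else 0) (m : ℕ) [NeZero m] :
    trace (M ^ m) =
      ({f : ℤ → n | (∀ i, r (f i) (f (i + 1))) ∧ Function.Periodic f m}.ncard : R) := by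
  rw [← image_comp_intCast_eq_setOf_periodic,
    Set.ncard_image_of_injective _ (injective_comp_intCast m), trace_pow_eq_sum_prod,
    Set.ncard_eq_toFinset_card']
  simp only [hM, Finset.prod_ite_zero, Finset.mem_univ, true_imp_iff, Finset.prod_const_one,
    Finset.sum_boole, Set.toFinset_ofPred]

end PeriodicSequences

section Nonbacktracking

open Matrix

variable {V : Type*} (G : SimpleGraph V)

/-- A two-sided infinite walk that never turns back. -/
def IsNonbacktracking (c : ℤ → V) : Prop := ∀ i, G.Adj (c i) (c (i + 1)) ∧ c (i + 2) ≠ c i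

/-- A nonbacktracking walk is the same as a sequence of darts, each of which starts where the
previous one ends and is not its reversal. -/
def nonbacktrackingEquivDarts (m : ℕ) :
    {c : ℤ → V | IsNonbacktracking G c ∧ Function.Periodic c m} ≃
      {f : ℤ → G.Dart | (∀ i, (f i).snd = (f (i + 1)).fst ∧ f (i + 1) ≠ (f i).symm) ∧
        Function.Periodic f m} where
  toFun c := ⟨fun i => ⟨(c.1 i, c.1 (i + 1)), (c.2.1 i).1⟩,
    fun i => ⟨rfl, fun h => (c.2.1 i).2 (by
      simpa [add_assoc] using congrArg (fun d : G.Dart => d.snd) h)⟩,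
    fun i => by
      ext1
      simp only [add_right_comm i _ 1, c.2.2 _]⟩
  invFun f := ⟨fun i => (f.1 i).fst,
    fun i => ⟨(f.2.1 i).1.subst (motive := G.Adj (f.1 i).fst) (f.1 i).adj, fun h => (f.2.1 i).2 (by
      ext1
      refine Prod.ext (f.2.1 i).1.symm ((f.2.1 (i + 1)).1.trans ?_)
      simpa [add_assoc] using h)⟩,
    fun i => by simp only [f.2.2 i]⟩
  left_inv c := rfl
  right_inv f := by
    ext i : 3
    exact Prod.ext rfl (f.2.1 i).1.symm

variable (R : Type*) [CommRing R]

theorem natCast_card_dart_eq [Fintype V] [DecidableRel G.Adj] {q : ℕ}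
    (hG : G.IsRegularOfDegree (q + 1)) :
    (Fintype.card G.Dart : R) = (q + 1) * Fintype.card V := by
  simp [G.dart_card_eq_sum_degrees, hG.degree_eq, mul_comm]

variable [DecidableEq V]

/-- The incidence matrix of the vertices and the darts starting there. -/
def dartStart : Matrix V G.Dart R := Matrix.of fun v d => if d.fst = v then 1 else 0

/-- The incidence matrix of the darts and their end points. -/
def dartEnd : Matrix G.Dart V R := Matrix.of fun d v => if d.snd = v then 1 else 0

/-- The permutation matrix of the reversal of darts. -/
def dartFlip : Matrix G.Dart G.Dart R := Matrix.of fun d e => if e = d.symm then 1 else 0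

variable [Fintype V]

theorem dartEnd_mul_dartStart_sub_dartFlip_apply (d e : G.Dart) :
    (dartEnd G R * dartStart G R - dartFlip G R) d e =
      if d.snd = e.fst ∧ e ≠ d.symm then 1 else 0 := by
  have h : (dartEnd G R * dartStart G R) d e = if d.snd = e.fst then 1 else 0 := by
    simp [Matrix.mul_apply, dartStart, dartEnd, eq_comm]
  rw [Matrix.sub_apply, h, dartFlip, Matrix.of_apply]
  by_cases he : e = d.symm
  · simp [he]
  · simp [he]

variable [DecidableRel G.Adj]

theorem dartStart_mul_dartEnd : dartStart G R * dartEnd G R = G.adjMatrix R := by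
  ext u v
  simp only [Matrix.mul_apply, dartStart, dartEnd, Matrix.of_apply, ite_mul, one_mul, zero_mul,
    ← ite_and, SimpleGraph.adjMatrix_apply]
  split_ifs with huv
  · rw [Finset.sum_eq_single ⟨(u, v), huv⟩]
    · simp
    · exact fun d _ hd => if_neg fun h => hd (SimpleGraph.Dart.ext _ _ (Prod.ext h.1 h.2))
    · simp
  · exact Finset.sum_eq_zero fun d _ => if_neg (by
      rintro ⟨rfl, rfl⟩
      exact huv d.adj)

theorem dartFlip_mul_apply {W : Type*} (M : Matrix G.Dart W R) (d : G.Dart) (w : W) :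
    (dartFlip G R * M) d w = M d.symm w := by
  simp [Matrix.mul_apply, dartFlip]

theorem dartFlip_mul_self : dartFlip G R * dartFlip G R = 1 := by
  ext d e
  rw [dartFlip_mul_apply]
  simp [dartFlip, Matrix.one_apply, eq_comm]

variable {q : ℕ}

theorem dartStart_mul_dartFlip_mul_dartEnd (hG : G.IsRegularOfDegree (q + 1)) :
    dartStart G R * dartFlip G R * dartEnd G R = ((q : R) + 1) • 1 := by
  ext u v
  have hfiber : ∑ d : G.Dart, (if d.fst = u then 1 else 0 : R) = q + 1 := by
    rw [Finset.sum_boole, G.dart_fst_fiber_card_eq_degree u, hG u, Nat.cast_succ]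
  rw [Matrix.mul_assoc, Matrix.mul_apply, Matrix.smul_apply, Matrix.one_apply, smul_eq_mul,
    ← hfiber, Finset.sum_mul]
  refine Finset.sum_congr rfl fun d _ => ?_
  rw [dartFlip_mul_apply, dartStart, dartEnd, Matrix.of_apply, Matrix.of_apply]
  split_ifs <;> simp_all

theorem ncard_periodic_nonbacktracking (hG : G.IsRegularOfDegree (q + 1)) (m : ℕ) :
    ({c : ℤ → V | IsNonbacktracking G c ∧ Function.Periodic c (m + 1 : ℕ)}.ncard : R) =
      trace (Polynomial.aeval (G.adjMatrix R) (Polynomial.dickson 1 (q : R) (m + 1))) +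
        if Even (m + 1) then ((q : R) - 1) * Fintype.card V else 0 := by
  have htrace := trace_nonbacktracking_pow (dartFlip_mul_self G R)
    (dartStart_mul_dartFlip_mul_dartEnd G R hG)
    (Finset.sum_eq_zero fun d _ => by simp [dartFlip, d.symm_ne.symm])
    (by simp [dartStart_mul_dartEnd])
    (by simp only [dartStart_mul_dartEnd, trace, Matrix.diag_apply,
      SimpleGraph.adjMatrix_mul_self_apply_self, hG.degree_eq, Finset.sum_const, Finset.card_univ,
      nsmul_eq_mul, mul_comm, Nat.cast_succ])
    (natCast_card_dart_eq G R hG) m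
  rw [dartStart_mul_dartEnd,
    trace_pow_eq_ncard_periodic (dartEnd_mul_dartStart_sub_dartFlip_apply G R)] at htrace
  rw [← htrace, ← Nat.card_coe_set_eq, ← Nat.card_coe_set_eq,
    Nat.card_congr (nonbacktrackingEquivDarts G (m + 1))]

end Nonbacktracking

/-! ### Closed paths as cycles of the shift -/

section Shift

variable {α : Type*}

/-- The shift on two-sided sequences. Its cycles encode sequences up to a change of origin. -/
def shift (α : Type*) : Equiv.Perm (ℤ → α) where
  toFun c i := c (i + 1)
  invFun c i := c (i - 1)
  left_inv c := by simp
  right_inv c := by simp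

theorem shift_apply (c : ℤ → α) (i : ℤ) : shift α c i = c (i + 1) := rfl

theorem shift_symm_apply (c : ℤ → α) (i : ℤ) : (shift α).symm c i = c (i - 1) := rfl

theorem shift_zpow_apply (s : ℤ) (c : ℤ → α) (i : ℤ) : (shift α ^ s) c i = c (i + s) := by
  induction s generalizing i with
  | zero => simp
  | succ n ih => rw [add_comm, zpow_add, zpow_one, Equiv.Perm.mul_apply, shift_apply, ih, add_assoc]
  | pred n ih =>
    rw [sub_eq_neg_add, zpow_add, zpow_neg_one, Equiv.Perm.mul_apply, Equiv.Perm.inv_def,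
      shift_symm_apply, ih]
    congr 1
    ring

theorem sameCycle_shift_iff {c d : ℤ → α} :
    (shift α).SameCycle c d ↔ ∃ s : ℤ, ∀ i, c (i + s) = d i := by
  simp only [Equiv.Perm.SameCycle, funext_iff, shift_zpow_apply]

theorem isPeriodicPt_shift_iff {c : ℤ → α} {m : ℕ} :
    Function.IsPeriodicPt (shift α) m c ↔ Function.Periodic c m := by
  rw [Function.IsPeriodicPt, Function.IsFixedPt, Equiv.Perm.iterate_eq_pow, ← zpow_natCast]
  simp only [funext_iff, shift_zpow_apply, Function.Periodic]

end Shift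

section ClosedSeq

variable {V : Type*} {G : SimpleGraph V} {u v w : V}

/-- The vertices of a closed walk as a periodic two-sided sequence. -/
def closedSeq (p : G.Walk v v) : ℤ → V := fun i => p.getVert (i % p.length).toNat

theorem periodic_closedSeq (p : G.Walk v v) : Function.Periodic (closedSeq p) p.length :=
  fun i => by simp [closedSeq]

theorem closedSeq_natCast (p : G.Walk v v) {i : ℕ} (hi : i ≤ p.length) :
    closedSeq p i = p.getVert i := by
  rcases hi.eq_or_lt with rfl | h
  · simp [closedSeq]
  · rw [closedSeq, ← Int.natCast_mod, Int.toNat_natCast, Nat.mod_eq_of_lt h]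

theorem closedSeq_zero (p : G.Walk v v) : closedSeq p 0 = v := by
  simp [closedSeq]

theorem closedSeq_nil : closedSeq (.nil : G.Walk v v) = fun _ => v := by
  ext i
  simp [closedSeq]

theorem closedSeq_eq {p : G.Walk v v} {c : ℤ → V} (hp : 0 < p.length)
    (hc : Function.Periodic c p.length) (h : ∀ i < p.length, p.getVert i = c i) :
    closedSeq p = c := by
  ext i
  have hlt := Int.emod_lt_of_pos i (Int.natCast_pos.mpr hp)
  have hnonneg := Int.emod_nonneg i (Int.natCast_pos.mpr hp).ne'
  rw [closedSeq, h _ (by omega), Int.toNat_of_nonneg hnonneg, periodic_apply_emod hc]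

theorem adj_closedSeq (p : G.Walk v v) (hp : 0 < p.length) (i : ℤ) :
    G.Adj (closedSeq p i) (closedSeq p (i + 1)) := by
  obtain ⟨k, hk⟩ := Int.eq_ofNat_of_zero_le (Int.emod_nonneg i (Int.natCast_pos.mpr hp).ne')
  have hlt : k < p.length := by
    exact_mod_cast hk ▸ Int.emod_lt_of_pos i (Int.natCast_pos.mpr hp)
  have hsucc : closedSeq p (i + 1) = closedSeq p (k + 1 : ℕ) := by
    rw [← periodic_apply_emod (periodic_closedSeq p), ← Int.emod_add_emod, hk,
      periodic_apply_emod (periodic_closedSeq p), Nat.cast_succ]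
  rw [← periodic_apply_emod (periodic_closedSeq p) i, hk, hsucc, closedSeq_natCast p hlt.le,
    closedSeq_natCast p hlt]
  exact p.adj_getVert_succ hlt

theorem closedSeq_append_comm (p : G.Walk u v) (q : G.Walk v u) :
    closedSeq (q.append p) = (shift V ^ (p.length : ℤ)) (closedSeq (p.append q)) := by
  have hlen : (q.append p).length = p.length + q.length := by
    rw [SimpleGraph.Walk.length_append, add_comm]
  have hper := periodic_closedSeq (p.append q)
  rw [SimpleGraph.Walk.length_append] at hper
  rcases Nat.eq_zero_or_pos (q.append p).length with h0 | hpos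
  · obtain ⟨hp, hq⟩ : p.length = 0 ∧ q.length = 0 := by omega
    cases p <;> cases q <;> simp_all [closedSeq_nil]
  refine closedSeq_eq hpos (fun i => ?_) fun i hi => ?_
  · rw [shift_zpow_apply, shift_zpow_apply, hlen, add_right_comm, hper]
  rw [shift_zpow_apply, SimpleGraph.Walk.getVert_append]
  split_ifs with hiq
  · rw [← Nat.cast_add, closedSeq_natCast _ (by rw [SimpleGraph.Walk.length_append]; omega),
      SimpleGraph.Walk.getVert_append, if_neg (by omega), Nat.add_sub_cancel]
  · rw [show (i + p.length : ℤ) = (i - q.length : ℕ) + (p.length + q.length : ℕ) by omega, hper,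
      closedSeq_natCast _ (by rw [SimpleGraph.Walk.length_append]; omega),
      SimpleGraph.Walk.getVert_append, if_pos (by omega)]

theorem closedSeq_reverse (p : G.Walk v v) :
    closedSeq p.reverse = fun i => closedSeq p (-i) := by
  rcases Nat.eq_zero_or_pos p.length with h0 | hpos
  · cases p <;> simp_all [closedSeq_nil]
  · refine closedSeq_eq (by simpa) (fun i => ?_) fun i hi => ?_
    · rw [SimpleGraph.Walk.length_reverse, neg_add, ← sub_eq_add_neg,
        (periodic_closedSeq p).sub_eq]
    · rw [SimpleGraph.Walk.length_reverse] at hi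
      rw [SimpleGraph.Walk.getVert_reverse, ← closedSeq_natCast p (Nat.sub_le _ _),
        ← periodic_closedSeq p (-i), Nat.cast_sub hi.le, sub_eq_neg_add]

theorem length_walkPow (p : G.Walk v v) (k : ℕ) :
    (ClosedPath.walkPow p k).length = k * p.length := by
  induction k with
  | zero => simp [ClosedPath.walkPow]
  | succ k ih => rw [ClosedPath.walkPow, SimpleGraph.Walk.length_append, ih]; ring

theorem getVert_walkPow (p : G.Walk v v) (k : ℕ) {i : ℕ} (hi : i ≤ k * p.length) :
    (ClosedPath.walkPow p k).getVert i = closedSeq p i := by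
  induction k generalizing i with
  | zero =>
    obtain rfl : i = 0 := by simpa using hi
    simp [closedSeq_zero]
  | succ k ih =>
    rw [add_mul, one_mul] at hi
    rw [ClosedPath.walkPow, SimpleGraph.Walk.getVert_append]
    split_ifs with h
    · rw [closedSeq_natCast p h.le]
    · rw [ih (by omega), Nat.cast_sub (not_lt.mp h), (periodic_closedSeq p).sub_eq]

theorem closedSeq_walkPow (p : G.Walk v v) {k : ℕ} (hk : 0 < k) (hp : 0 < p.length) :
    closedSeq (ClosedPath.walkPow p k) = closedSeq p := by
  have hlen := length_walkPow p k
  refine closedSeq_eq (hlen ▸ Nat.mul_pos hk hp) ?_ fun i hi => getVert_walkPow p k (hlen ▸ hi.le)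
  rw [hlen, Nat.cast_mul]
  exact (periodic_closedSeq p).int_mul k

theorem exists_walk_getVert_eq {c : ℕ → V} (hc : ∀ i, G.Adj (c i) (c (i + 1))) (m : ℕ) :
    ∃ p : G.Walk (c 0) (c m), p.length = m ∧ ∀ i ≤ m, p.getVert i = c i := by
  induction m with
  | zero => exact ⟨.nil, rfl, fun i hi => by simp [Nat.le_zero.mp hi]⟩
  | succ m ih =>
    obtain ⟨p, hl, hp⟩ := ih
    refine ⟨p.concat (hc m), by simp [hl], fun i hi => ?_⟩
    rw [SimpleGraph.Walk.concat_eq_append, SimpleGraph.Walk.getVert_append, hl]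
    split_ifs with h
    · exact hp i h.le
    · obtain rfl | rfl : i = m ∨ i = m + 1 := by omega
      all_goals simp

theorem exists_closedSeq_eq {c : ℤ → V} (hc : ∀ i, G.Adj (c i) (c (i + 1))) {m : ℕ} (hm : 0 < m)
    (hper : Function.Periodic c m) :
    ∃ (v : V) (p : G.Walk v v), p.length = m ∧ closedSeq p = c := by
  obtain ⟨p, hl, hp⟩ := exists_walk_getVert_eq (c := fun i : ℕ => c i) (fun i => hc i) m
  have h0 : c m = c (0 : ℕ) := by simpa using hper 0
  refine ⟨_, p.copy rfl h0, by simpa using hl, closedSeq_eq (by simpa [hl]) (by simpa [hl]) ?_⟩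
  intro i hi
  rw [SimpleGraph.Walk.length_copy, hl] at hi
  rw [SimpleGraph.Walk.getVert_copy, hp i hi.le]

namespace ClosedPath

/-- The cycle of the shift consisting of the vertex sequences of a closed path, one for each choice
of the starting vertex. -/
def cycle : ClosedPath G → Quotient (Equiv.Perm.SameCycle.setoid (shift V)) :=
  Quot.lift (fun p => ⟦closedSeq p.2⟧) (by
    rintro _ _ ⟨p, q⟩
    exact Quotient.sound ⟨_, (closedSeq_append_comm p q).symm⟩)

theorem exists_ofWalk_eq_and_closedSeq_eq (p : G.Walk v v) (s : ℤ) :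
    ∃ (w : V) (q : G.Walk w w),
      ofWalk q = ofWalk p ∧ closedSeq q = (shift V ^ s) (closedSeq p) := by
  rcases Nat.eq_zero_or_pos p.length with h0 | hpos
  · refine ⟨v, p, rfl, funext fun i => ?_⟩
    cases p <;> simp_all [closedSeq_nil, shift_zpow_apply]
  obtain ⟨k, hk⟩ := Int.eq_ofNat_of_zero_le (Int.emod_nonneg s (Int.natCast_pos.mpr hpos).ne')
  have hlt : k < p.length := by
    exact_mod_cast hk ▸ Int.emod_lt_of_pos s (Int.natCast_pos.mpr hpos)
  have htd := p.append_take_drop_eq k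
  refine ⟨_, (p.drop k).append (p.take k), ?_, funext fun i => ?_⟩
  · conv_rhs => rw [← htd]
    exact (Quot.sound (IsRotation.mk _ _)).symm
  · rw [closedSeq_append_comm, htd, SimpleGraph.Walk.take_length, min_eq_left hlt.le,
      shift_zpow_apply, shift_zpow_apply, ← periodic_apply_emod (periodic_closedSeq p) (i + s),
      ← Int.add_emod_emod, hk, periodic_apply_emod (periodic_closedSeq p)]

theorem ofWalk_eq_of_closedSeq_eq {p : G.Walk v v} {q : G.Walk w w} (hl : p.length = q.length)
    (h : closedSeq p = closedSeq q) : ofWalk p = ofWalk q := by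
  obtain rfl : v = w := by rw [← closedSeq_zero p, h, closedSeq_zero]
  rw [SimpleGraph.Walk.ext_getVert_le_length hl fun k hk => by
    rw [← closedSeq_natCast p hk, h, closedSeq_natCast q (hl ▸ hk)]]

theorem ext_length_cycle {γ δ : ClosedPath G} (hl : γ.length = δ.length) (h : γ.cycle = δ.cycle) :
    γ = δ := by
  obtain ⟨⟨v, p⟩⟩ := γ
  obtain ⟨⟨w, q⟩⟩ := δ
  obtain ⟨s, hs⟩ := Quotient.exact h
  obtain ⟨x, r, hr, hrs⟩ := exists_ofWalk_eq_and_closedSeq_eq p s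
  have hrl : r.length = p.length := congrArg length hr
  exact hr.symm.trans (ofWalk_eq_of_closedSeq_eq (hrl.trans hl) (hrs.trans hs))

end ClosedPath

end ClosedSeq

/-! ### Closed geodesics are the nonbacktracking closed paths -/

section Holonomy

variable {V : Type*} [LinearOrder V] {G : SimpleGraph V} {u v w : V}

/-- The generator of the free group on the edges read along a dart, inverted if the dart decreases.
The linear order on the vertices only serves to orient the edges. -/
def dartLetter (d : G.Dart) : Sym2 V × Bool := (d.edge, decide (d.fst < d.snd))

/-- The element of the free group on the edges spelled by a walk. -/
def holonomy (p : G.Walk u v) : FreeGroup (Sym2 V) := FreeGroup.mk (p.darts.map dartLetter)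

theorem mk_dartLetter_symm (d : G.Dart) :
    FreeGroup.mk [dartLetter d.symm] = (FreeGroup.mk [dartLetter d])⁻¹ := by
  rcases d.fst_ne_snd.lt_or_gt with h | h <;>
    simp [FreeGroup.inv_mk, FreeGroup.invRev, dartLetter, h, h.not_gt]

theorem holonomy_append (p : G.Walk u v) (q : G.Walk v w) :
    holonomy (p.append q) = holonomy p * holonomy q := by
  rw [holonomy, SimpleGraph.Walk.darts_append, List.map_append, ← FreeGroup.mul_mk]
  rfl

theorem holonomy_cons (h : G.Adj u v) (p : G.Walk v w) :
    holonomy (.cons h p) = FreeGroup.mk [dartLetter ⟨(u, v), h⟩] * holonomy p := by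
  rw [holonomy, SimpleGraph.Walk.darts_cons, List.map_cons, ← List.singleton_append,
    ← FreeGroup.mul_mk]
  rfl

theorem holonomy_cons_cons_symm (h : G.Adj u v) (p : G.Walk u w) :
    holonomy (.cons h (.cons h.symm p)) = holonomy p := by
  rw [holonomy_cons, holonomy_cons,
    show (⟨(v, u), h.symm⟩ : G.Dart) = (⟨(u, v), h⟩ : G.Dart).symm from rfl, mk_dartLetter_symm,
    mul_inv_cancel_left]

theorem holonomy_walkPow (p : G.Walk v v) (k : ℕ) :
    holonomy (ClosedPath.walkPow p k) = holonomy p ^ k := by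
  induction k with
  | zero => rfl
  | succ k ih => rw [ClosedPath.walkPow, holonomy_append, ih, pow_succ']

theorem isReduced_map_dartLetter {p : G.Walk u v}
    (hp : ∀ i, i + 2 ≤ p.length → p.getVert (i + 2) ≠ p.getVert i) :
    FreeGroup.IsReduced (p.darts.map dartLetter) := by
  rw [FreeGroup.IsReduced, List.isChain_iff_getElem]
  intro i hi
  rw [List.length_map, SimpleGraph.Walk.length_darts] at hi
  simp only [List.getElem_map, SimpleGraph.Walk.darts_getElem_eq_getVert, dartLetter]
  intro h
  rcases Sym2.eq_iff.mp h with ⟨h1, -⟩ | ⟨h1, -⟩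
  · exact absurd h1 (p.adj_getVert_succ (by omega)).ne
  · exact absurd h1.symm (hp i hi)

theorem norm_holonomy_le (p : G.Walk u v) : (holonomy p).norm ≤ p.length :=
  FreeGroup.norm_mk_le.trans_eq (by simp)

theorem norm_holonomy {p : G.Walk u v}
    (hp : ∀ i, i + 2 ≤ p.length → p.getVert (i + 2) ≠ p.getVert i) :
    (holonomy p).norm = p.length := by
  rw [holonomy, FreeGroup.norm, FreeGroup.toWord_mk, (isReduced_map_dartLetter hp).reduce_eq,
    List.length_map, SimpleGraph.Walk.length_darts]

theorem norm_holonomy_pow {p : G.Walk v v} (hp : IsNonbacktracking G (closedSeq p)) (k : ℕ) :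
    (holonomy p ^ k).norm = k * p.length := by
  rw [← holonomy_walkPow, norm_holonomy, length_walkPow]
  intro i hi
  rw [length_walkPow] at hi
  rw [getVert_walkPow p k hi, getVert_walkPow p k (by omega)]
  exact_mod_cast (hp i).2

/-- The conjugacy class of the holonomy of a closed path, an invariant of its free homotopy
class. -/
def holonomyClass : ClosedPath G → ConjClasses (FreeGroup (Sym2 V)) :=
  Quot.lift (fun p => ConjClasses.mk (holonomy p.2)) (by
    rintro _ _ ⟨p, q⟩
    rw [ConjClasses.mk_eq_mk_iff_isConj, holonomy_append, holonomy_append, isConj_iff]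
    exact ⟨(holonomy p)⁻¹, by group⟩)

theorem holonomyClass_eq_of_freelyHomotopic {γ δ : ClosedPath G} (h : γ.FreelyHomotopic δ) :
    holonomyClass γ = holonomyClass δ := by
  induction h with
  | rel a b hab =>
    obtain ⟨p, q, h⟩ := hab
    change ConjClasses.mk (holonomy (p.append q)) = ConjClasses.mk (holonomy (p.append _))
    rw [holonomy_append, holonomy_append, holonomy_cons_cons_symm]
  | refl a => rfl
  | symm a b _ ih => exact ih.symm
  | trans a b c _ _ ih1 ih2 => exact ih1.trans ih2

/- Comparing the norms of the `k`-th powers for large `k` removes the contribution of the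
conjugating element. -/
theorem length_le_of_isConj_holonomy {p : G.Walk v v} {q : G.Walk w w}
    (hp : IsNonbacktracking G (closedSeq p)) (h : IsConj (holonomy p) (holonomy q)) :
    p.length ≤ q.length := by
  obtain ⟨g, hg⟩ := isConj_iff.mp h.symm
  have key (k : ℕ) : k * p.length ≤ k * q.length + 2 * g.norm := calc
    k * p.length = (g * holonomy q ^ k * g⁻¹).norm := by
      rw [← norm_holonomy_pow hp, ← hg, conj_pow]
    _ ≤ g.norm + (holonomy q ^ k).norm + g⁻¹.norm :=
      (FreeGroup.norm_mul_le _ _).trans (Nat.add_le_add_right (FreeGroup.norm_mul_le _ _) _)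
    _ ≤ g.norm + k * q.length + g.norm := by
      rw [FreeGroup.norm_inv_eq, ← holonomy_walkPow, ← length_walkPow]
      gcongr
      exact norm_holonomy_le _
    _ = k * q.length + 2 * g.norm := by ring
  by_contra! hlt
  have := key (2 * g.norm + 1)
  nlinarith

end Holonomy

section Geodesics

variable {V : Type*} {G : SimpleGraph V} {v : V}

theorem isNonbacktracking_of_isClosedGeodesic {p : G.Walk v v}
    (h : (ClosedPath.ofWalk p).IsClosedGeodesic) : IsNonbacktracking G (closedSeq p) := by
  refine fun i => ⟨adj_closedSeq p h.1 i, fun hi => ?_⟩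
  obtain ⟨w, q, hq, hs⟩ := ClosedPath.exists_ofWalk_eq_and_closedSeq_eq p i
  rw [← hq] at h
  have h2 : closedSeq q (2 : ℕ) = closedSeq q 0 := by
    rw [hs, shift_zpow_apply, shift_zpow_apply, zero_add, add_comm]
    exact hi
  rw [closedSeq_zero] at h2
  match q, h, h2 with
  | .nil, h, _ => exact absurd h.1 (lt_irrefl 0)
  | .cons hw .nil, _, _ => exact hw.ne rfl
  | .cons (v := x) hx (.cons (v := y) hy r), h, h2 =>
    rw [closedSeq_natCast _ (by simp)] at h2
    obtain rfl : y = w := by simpa using h2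
    have hle : r.length + 2 ≤ r.length := h.2 (ClosedPath.ofWalk r)
      (.symm _ _ (.rel _ _ (ClosedPath.ElementaryHomotopy.mk .nil r hx)))
    omega

theorem isClosedGeodesic_iff {p : G.Walk v v} :
    (ClosedPath.ofWalk p).IsClosedGeodesic ↔ 0 < p.length ∧ IsNonbacktracking G (closedSeq p) := by
  refine ⟨fun h => ⟨h.1, isNonbacktracking_of_isClosedGeodesic h⟩, fun ⟨h0, h⟩ => ⟨h0, ?_⟩⟩
  obtain ⟨_, -⟩ := exists_wellFoundedLT V
  rintro ⟨w, q⟩ hq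
  exact length_le_of_isConj_holonomy h
    (ConjClasses.mk_eq_mk_iff_isConj.mp (holonomyClass_eq_of_freelyHomotopic hq))

theorem IsNonbacktracking.three_le_of_periodic {c : ℤ → V} (hc : IsNonbacktracking G c) {m : ℕ}
    (hm : 0 < m) (hper : Function.Periodic c m) : 3 ≤ m := by
  by_contra! hlt
  obtain rfl | rfl : m = 1 ∨ m = 2 := by omega
  · exact (hc 0).1.ne (hper 0).symm
  · exact (hc 0).2 (hper 0)

theorem three_le_length_of_isClosedGeodesic {γ : ClosedPath G} (h : γ.IsClosedGeodesic) :
    3 ≤ γ.length := by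
  obtain ⟨⟨v, p⟩⟩ := γ
  exact (isNonbacktracking_of_isClosedGeodesic h).three_le_of_periodic h.1 (periodic_closedSeq p)

theorem minimalPeriod_eq_of_sameCycle {α : Type*} {f : Equiv.Perm α} {x y : α}
    (h : f.SameCycle x y) : Function.minimalPeriod f x = Function.minimalPeriod f y := by
  obtain ⟨i, rfl⟩ := h
  refine Function.minimalPeriod_eq_minimalPeriod_iff.mpr fun n => ?_
  simp only [Function.IsPeriodicPt, Function.IsFixedPt, Equiv.Perm.iterate_eq_pow, ← zpow_natCast,
    ← Equiv.Perm.mul_apply, ← zpow_add]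
  rw [add_comm, zpow_add, Equiv.Perm.mul_apply, (f ^ i).apply_eq_iff_eq]

theorem isPrimitiveGeodesic_iff {p : G.Walk v v} :
    (ClosedPath.ofWalk p).IsPrimitiveGeodesic ↔ 0 < p.length ∧ IsNonbacktracking G (closedSeq p) ∧
      Function.minimalPeriod (shift V) (closedSeq p) = p.length := by
  rw [ClosedPath.IsPrimitiveGeodesic, isClosedGeodesic_iff, and_assoc]
  refine and_congr_right fun hpos => and_congr_right fun hn => ?_
  have hper := isPeriodicPt_shift_iff.mpr (periodic_closedSeq p)
  constructor
  · intro h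
    by_contra hne
    have hlt := (hper.minimalPeriod_le hpos).lt_of_ne hne
    obtain ⟨k, hk⟩ := hper.minimalPeriod_dvd
    have hk0 : 0 < k := Nat.pos_of_ne_zero (by rintro rfl; omega)
    obtain ⟨w, q, hql, hqs⟩ := exists_closedSeq_eq (fun i => (hn i).1) (hper.minimalPeriod_pos hpos)
      (isPeriodicPt_shift_iff.mp (Function.isPeriodicPt_minimalPeriod (shift V) (closedSeq p)))
    have hq0 : 0 < q.length := hql ▸ hper.minimalPeriod_pos hpos
    refine h ⟨ClosedPath.ofWalk q, isClosedGeodesic_iff.mpr ⟨hq0, by rwa [hqs]⟩,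
      hql.trans_lt hlt, w, q, k, rfl, ClosedPath.ofWalk_eq_of_closedSeq_eq ?_ ?_⟩
    · rw [length_walkPow, hql, hk, mul_comm]
    · rw [closedSeq_walkPow q hk0 hq0, hqs]
  · rintro hm ⟨_, hδ, hlt, w, q, k, rfl, hpk⟩
    have hq0 : 0 < q.length := hδ.1
    have hl : p.length = k * q.length := (congrArg ClosedPath.length hpk).trans (length_walkPow q k)
    have hk0 : 0 < k := Nat.pos_of_ne_zero (by rintro rfl; omega)
    have hcycle : (shift V).SameCycle (closedSeq p) (closedSeq (ClosedPath.walkPow q k)) :=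
      Quotient.exact (congrArg ClosedPath.cycle hpk)
    rw [closedSeq_walkPow q hk0 hq0] at hcycle
    refine hlt.not_ge (hm.symm.trans_le ?_)
    rw [minimalPeriod_eq_of_sameCycle hcycle]
    exact (isPeriodicPt_shift_iff.mpr (periodic_closedSeq q)).minimalPeriod_le hq0

end Geodesics

/-! ### Counting primitive geodesics -/

section Counting

variable {α : Type*}

theorem ncard_inter_ptsOfPeriod {f : α → α} {S : Set α} {m : ℕ} (hm : m ≠ 0)
    (hfin : (S ∩ Function.ptsOfPeriod f m).Finite) :
    (S ∩ Function.ptsOfPeriod f m).ncard =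
      ∑ l ∈ m.divisors, {x ∈ S | Function.minimalPeriod f x = l}.ncard := by
  classical
  rw [Set.ncard_eq_toFinset_card _ hfin, Finset.card_eq_sum_card_fiberwise
    (f := Function.minimalPeriod f) (t := m.divisors)]
  · refine Finset.sum_congr rfl fun l hl => ?_
    rw [← Set.ncard_coe_finset]
    congr 1
    ext x
    simp only [Finset.coe_filter, Set.Finite.mem_toFinset, Set.mem_inter_iff, Set.mem_ofPred_eq,
      Function.ptsOfPeriod, Function.isPeriodicPt_iff_minimalPeriod_dvd]
    exact ⟨fun h => ⟨h.1.1, h.2⟩, fun h => ⟨⟨h.1, h.2 ▸ Nat.dvd_of_mem_divisors hl⟩, h.2⟩⟩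
  · intro x hx
    exact Nat.mem_divisors.mpr
      ⟨Function.IsPeriodicPt.minimalPeriod_dvd (hfin.mem_toFinset.mp hx).2, hm⟩

theorem exists_lt_minimalPeriod_iterate_eq {f : Equiv.Perm α} {x y : α}
    (hx : 0 < Function.minimalPeriod f x) (h : f.SameCycle x y) :
    ∃ k < Function.minimalPeriod f x, f^[k] x = y := by
  obtain ⟨i, rfl⟩ := h
  have hx' : (0 : ℤ) < Function.minimalPeriod f x := Int.natCast_pos.mpr hx
  obtain ⟨k, hk⟩ := Int.eq_ofNat_of_zero_le (Int.emod_nonneg i hx'.ne')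
  refine ⟨k, by exact_mod_cast hk ▸ Int.emod_lt_of_pos i hx', ?_⟩
  rw [Equiv.Perm.iterate_eq_pow, ← zpow_natCast, ← hk]
  exact MulAction.zpow_smul_mod_minimalPeriod f x i

theorem ncard_eq_mul_ncard_image_sameCycle {f : Equiv.Perm α} {S : Set α} {l : ℕ} (hl : 0 < l)
    (hS : ∀ x ∈ S, ∀ y, f.SameCycle x y → y ∈ S)
    (hper : ∀ x ∈ S, Function.minimalPeriod f x = l) :
    S.ncard = l * (Quotient.mk (Equiv.Perm.SameCycle.setoid f) '' S).ncard := by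
  set T := Quotient.mk (Equiv.Perm.SameCycle.setoid f) '' S
  have hiter (x : α) (k : ℕ) : f.SameCycle x (f^[k] x) := ⟨k, by simp [Equiv.Perm.iterate_eq_pow]⟩
  have hout (x : α) : f.SameCycle x (⟦x⟧ : Quotient (Equiv.Perm.SameCycle.setoid f)).out :=
    (Quotient.mk_out (s := Equiv.Perm.SameCycle.setoid f) x).symm
  have houtS : ∀ y ∈ T, y.out ∈ S := by
    rintro _ ⟨x, hx, rfl⟩
    exact hS x hx _ (hout x)
  have himage : (fun z : _ × ℕ => f^[z.2] z.1.out) '' (T ×ˢ Set.Iio l) = S := by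
    refine Set.Subset.antisymm ?_ fun x hx => ?_
    · rintro _ ⟨⟨y, k⟩, ⟨hy, -⟩, rfl⟩
      exact hS _ (houtS y hy) _ (hiter _ k)
    · have hlx := hper _ (hS x hx _ (hout x))
      obtain ⟨k, hk, hkx⟩ := exists_lt_minimalPeriod_iterate_eq (hlx ▸ hl) (hout x).symm
      exact ⟨(⟦x⟧, k), ⟨⟨x, hx, rfl⟩, hlx ▸ hk⟩, hkx⟩
  have hinj : (T ×ˢ Set.Iio l).InjOn fun z : _ × ℕ => f^[z.2] z.1.out := by
    rintro ⟨y, j⟩ ⟨hy, hj⟩ ⟨z, k⟩ ⟨-, hk⟩ h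
    change f^[j] y.out = f^[k] z.out at h
    obtain rfl : y = z := Quotient.out_equiv_out.mp
      ((hiter y.out j).trans (h ▸ (hiter z.out k).symm))
    rw [← hper _ (houtS y hy)] at hj hk
    exact Prod.ext rfl (Function.iterate_injOn_Iio_minimalPeriod hj hk h)
  rw [← himage, hinj.ncard_image, Set.ncard_prod, Set.ncard_Iio_nat, mul_comm]

theorem ncard_eq_two_mul_ncard_image_sym2 {S : Set α} (hfin : S.Finite) {r : α → α}
    (hr : ∀ x ∈ S, r x ∈ S) (hinv : ∀ x ∈ S, r (r x) = x) (hne : ∀ x ∈ S, r x ≠ x) :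
    S.ncard = 2 * ((fun x => s(x, r x)) '' S).ncard := by
  classical
  lift S to Finset α using hfin
  rw [← Finset.coe_image, Set.ncard_coe_finset, Set.ncard_coe_finset, mul_comm,
    Finset.card_eq_sum_card_image (fun x => s(x, r x)) S]
  refine Finset.sum_const_nat fun z hz => ?_
  obtain ⟨x, hx, rfl⟩ := Finset.mem_image.mp hz
  rw [← Finset.card_pair (hne x hx).symm]
  congr 1
  ext y
  simp only [Finset.mem_filter, Finset.mem_insert, Finset.mem_singleton, Sym2.eq_iff]
  constructor
  · rintro ⟨-, h | h⟩
    · exact .inl h.1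
    · exact .inr h.1
  · rintro (rfl | rfl)
    · exact ⟨hx, .inl ⟨rfl, rfl⟩⟩
    · exact ⟨hr x hx, .inr ⟨rfl, hinv x hx⟩⟩

end Counting

section PrimitiveGeodesics

variable {V : Type*} {G : SimpleGraph V}

theorem IsNonbacktracking.of_sameCycle {c d : ℤ → V} (hc : IsNonbacktracking G c)
    (h : (shift V).SameCycle c d) : IsNonbacktracking G d := by
  obtain ⟨s, hs⟩ := sameCycle_shift_iff.mp h
  intro i
  have hi := hc (i + s)
  rwa [add_right_comm i s 1, add_right_comm i s 2, hs, hs, hs] at hi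

theorem IsNonbacktracking.comp_neg {c : ℤ → V} (hc : IsNonbacktracking G c) :
    IsNonbacktracking G fun i => c (-i) := by
  intro i
  have h1 := (hc (-(i + 1))).1.symm
  have h2 := (hc (-(i + 2))).2.symm
  rw [show -(i + 1) + 1 = -i by ring] at h1
  rw [show -(i + 2) + 2 = -i by ring] at h2
  exact ⟨h1, h2⟩

theorem IsNonbacktracking.not_sameCycle_comp_neg {c : ℤ → V} (hc : IsNonbacktracking G c) :
    ¬(shift V).SameCycle c fun i => c (-i) := by
  intro h
  obtain ⟨s, hs⟩ := sameCycle_shift_iff.mp h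
  rcases Int.even_or_odd' s with ⟨k, rfl | rfl⟩
  · refine (hc (k - 1)).2 ?_
    have := hs (1 - k)
    ring_nf at this ⊢
    exact this
  · refine (hc k).1.ne ?_
    have := hs (-k)
    ring_nf at this ⊢
    exact this.symm

theorem minimalPeriod_shift_comp_neg {α : Type*} (c : ℤ → α) :
    Function.minimalPeriod (shift α) (fun i => c (-i)) = Function.minimalPeriod (shift α) c := by
  refine Function.minimalPeriod_eq_minimalPeriod_iff.mpr fun m => ?_
  simp only [isPeriodicPt_shift_iff]
  refine ⟨fun h i => ?_, fun h i => ?_⟩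
  · simpa [add_comm] using h.sub_eq (-i)
  · beta_reduce
    rw [neg_add, ← sub_eq_add_neg, h.sub_eq]

theorem reverse_reverse (γ : ClosedPath G) : γ.reverse.reverse = γ := by
  obtain ⟨⟨v, p⟩⟩ := γ
  exact congrArg ClosedPath.ofWalk p.reverse_reverse

theorem reverse_mem_primitiveGeodesics {γ : ClosedPath G} {l : ℕ}
    (h : γ ∈ primitiveGeodesics G l) : γ.reverse ∈ primitiveGeodesics G l := by
  obtain ⟨⟨v, p⟩⟩ := γ
  obtain ⟨hprim, hl⟩ := h
  obtain ⟨hp, hn, hm⟩ := isPrimitiveGeodesic_iff.mp hprim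
  refine ⟨isPrimitiveGeodesic_iff.mpr ?_, p.length_reverse.trans hl⟩
  rw [closedSeq_reverse, minimalPeriod_shift_comp_neg, p.length_reverse]
  exact ⟨hp, hn.comp_neg, hm⟩

theorem reverse_ne_of_isClosedGeodesic {γ : ClosedPath G} (h : γ.IsClosedGeodesic) :
    γ.reverse ≠ γ := by
  obtain ⟨⟨v, p⟩⟩ := γ
  intro he
  have hcycle : (shift V).SameCycle (closedSeq p) (closedSeq p.reverse) :=
    Quotient.exact (congrArg ClosedPath.cycle he.symm)
  rw [closedSeq_reverse] at hcycle
  exact (isNonbacktracking_of_isClosedGeodesic h).not_sameCycle_comp_neg hcycle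

theorem cycle_injOn_primitiveGeodesics (l : ℕ) :
    (primitiveGeodesics G l).InjOn ClosedPath.cycle := fun _ hγ _ hδ h =>
  ClosedPath.ext_length_cycle (hγ.2.trans hδ.2.symm) h

theorem image_cycle_primitiveGeodesics {l : ℕ} (hl : 0 < l) :
    ClosedPath.cycle '' primitiveGeodesics G l =
      Quotient.mk _ '' {c | IsNonbacktracking G c ∧ Function.minimalPeriod (shift V) c = l} := by
  ext x
  constructor
  · rintro ⟨⟨⟨v, p⟩⟩, ⟨hprim, rfl⟩, rfl⟩
    obtain ⟨-, hn, hm⟩ := isPrimitiveGeodesic_iff.mp hprim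
    exact ⟨closedSeq p, ⟨hn, hm⟩, rfl⟩
  · rintro ⟨c, ⟨hn, rfl⟩, rfl⟩
    obtain ⟨v, p, hpl, rfl⟩ := exists_closedSeq_eq (fun i => (hn i).1) hl
      (isPeriodicPt_shift_iff.mp (Function.isPeriodicPt_minimalPeriod (shift V) c))
    exact ⟨.ofWalk p, ⟨isPrimitiveGeodesic_iff.mpr ⟨hpl ▸ hl, hn, hpl.symm⟩, hpl⟩, rfl⟩

theorem ncard_minimalPeriod_eq {l : ℕ} (hl : 0 < l) :
    {c | IsNonbacktracking G c ∧ Function.minimalPeriod (shift V) c = l}.ncard =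
      l * (primitiveGeodesics G l).ncard := by
  rw [ncard_eq_mul_ncard_image_sameCycle (f := shift V) hl ?_ fun c hc => hc.2,
    ← image_cycle_primitiveGeodesics hl, (cycle_injOn_primitiveGeodesics l).ncard_image]
  rintro c ⟨hc, hl⟩ d h
  exact ⟨hc.of_sameCycle h, (minimalPeriod_eq_of_sameCycle h).symm.trans hl⟩

variable [Finite V]

theorem finite_primitiveGeodesics (l : ℕ) : (primitiveGeodesics G l).Finite := by
  rcases Nat.eq_zero_or_pos l with rfl | hl
  · exact Set.finite_empty.subset fun γ hγ => hγ.1.1.1.ne' hγ.2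
  have : NeZero l := ⟨hl.ne'⟩
  rw [← Set.finite_image_iff (cycle_injOn_primitiveGeodesics l), image_cycle_primitiveGeodesics hl]
  refine ((finite_setOf_periodic V l).subset ?_).image _
  rintro c ⟨-, rfl⟩
  exact isPeriodicPt_shift_iff.mp (Function.isPeriodicPt_minimalPeriod (shift V) c)

theorem ncard_primitiveGeodesics (l : ℕ) :
    (primitiveGeodesics G l).ncard = 2 * multiplicity G l :=
  ncard_eq_two_mul_ncard_image_sym2 (finite_primitiveGeodesics l)
    (fun _ => reverse_mem_primitiveGeodesics) (fun γ _ => reverse_reverse γ)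
    fun _ hγ => reverse_ne_of_isClosedGeodesic hγ.1.1

theorem ncard_periodic_nonbacktracking_eq_sum_divisors (m : ℕ) [NeZero m] :
    {c | IsNonbacktracking G c ∧ Function.Periodic c (m : ℤ)}.ncard =
      ∑ l ∈ m.divisors, 2 * l * multiplicity G l := by
  have hset : {c | IsNonbacktracking G c ∧ Function.Periodic c (m : ℤ)} =
      {c | IsNonbacktracking G c} ∩ Function.ptsOfPeriod (shift V) m :=
    Set.ext fun c => and_congr_right fun _ => isPeriodicPt_shift_iff.symm
  have hfin := (finite_setOf_periodic V m).subset fun c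
    (hc : c ∈ {c | IsNonbacktracking G c ∧ Function.Periodic c (m : ℤ)}) => hc.2
  rw [hset, ncard_inter_ptsOfPeriod (NeZero.ne m) (hset ▸ hfin)]
  refine Finset.sum_congr rfl fun l hl => ?_
  rw [mul_assoc, mul_left_comm, ← ncard_primitiveGeodesics,
    ← ncard_minimalPeriod_eq (Nat.pos_of_mem_divisors hl)]
  rfl

end PrimitiveGeodesics

section Multiplicity

variable {V : Type*} (G : SimpleGraph V)

theorem multiplicity_eq_zero_of_lt {l : ℕ} (hl : l < 3) : multiplicity G l = 0 := by
  have : primitiveGeodesics G l = ∅ := Set.eq_empty_of_forall_notMem fun γ h =>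
    hl.not_ge (h.2 ▸ three_le_length_of_isClosedGeodesic h.1.1)
  simp [multiplicity, this]

end Multiplicity

/-! ### The trace formula -/

section Sums

theorem tsum_mul_sub_mul {ι : Type*} {w f g : ι → ℝ} (hf : Summable fun i => w i * f i)
    (hg : Summable fun i => w i * g i) (a : ℝ) :
    ∑' i, w i * (f i - a * g i) = ∑' i, w i * f i - a * ∑' i, w i * g i := by
  rw [← tsum_mul_left, ← hf.tsum_sub (hg.mul_left a)]
  exact tsum_congr fun i => by rw [mul_sub, mul_left_comm]

theorem one_div_card_mul_sum_sub_sq {ι : Type*} [Fintype ι] [Nonempty ι] (x : ι → ℝ) {μ : ℝ}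
    (hμ : μ = 1 / (Fintype.card ι : ℝ) * ∑ i, x i) :
    1 / (Fintype.card ι : ℝ) * ∑ i, (x i - μ) ^ 2 =
      1 / (Fintype.card ι : ℝ) * ∑ i, x i ^ 2 - μ ^ 2 := by
  have hsum : ∑ i, x i = Fintype.card ι * μ := by
    rw [hμ]
    field_simp
  simp only [sub_sq, mul_right_comm 2 _ μ, Finset.sum_add_distrib, Finset.sum_sub_distrib,
    ← Finset.mul_sum, hsum, Finset.sum_const, Finset.card_univ, nsmul_eq_mul]
  field_simp
  ring

theorem hasSum_prod_of_hasSum_mul_sum_divisors {f g : ℕ → ℝ} {a : ℝ} (hg : ∀ l, 0 ≤ g l)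
    (hs : Summable fun m : ℕ+ => |f m| * ∑ l ∈ (m : ℕ).divisors, g l)
    (h : HasSum (fun m : ℕ+ => f m * ∑ l ∈ (m : ℕ).divisors, g l) a) :
    HasSum (fun x : ℕ+ × ℕ+ => f (x.2 * x.1) * g x.1) a := by
  have hterm (m : ℕ+) (x : (m : ℕ).divisorsAntidiagonal) :
      f ((sigmaAntidiagonalEquivProd ⟨m, x⟩).2 * (sigmaAntidiagonalEquivProd ⟨m, x⟩).1) *
        g (sigmaAntidiagonalEquivProd ⟨m, x⟩).1 = f m * g x.1.1 := by
    have hx : x.1.2 * x.1.1 = m := mul_comm x.1.1 _ ▸ (Nat.mem_divisorsAntidiagonal.mp x.2).1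
    exact congrArg (fun n => f n * g x.1.1) hx
  have hfiber (c : ℝ) (m : ℕ+) : c * ∑ l ∈ (m : ℕ).divisors, g l =
      ∑ x : (m : ℕ).divisorsAntidiagonal, c * g x.1.1 := by
    rw [← Nat.sum_divisorsAntidiagonal (fun l _ => g l), Finset.mul_sum, ← Finset.sum_coe_sort]
  have hsum : Summable ((fun x : ℕ+ × ℕ+ => f (x.2 * x.1) * g x.1) ∘
      sigmaAntidiagonalEquivProd) := by
    refine .of_abs ((summable_sigma_of_nonneg fun _ => abs_nonneg _).mpr
      ⟨fun m => .of_finite, hs.congr fun m => ?_⟩)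
    rw [hfiber, tsum_fintype]
    refine Finset.sum_congr rfl fun x _ => ?_
    rw [Function.comp_apply, hterm, abs_mul, abs_of_nonneg (hg _)]
  have hsigma := hsum.hasSum.sigma fun m => (hasSum_fintype _).congr_fun fun x => hterm m x
  rw [← sigmaAntidiagonalEquivProd.hasSum_iff,
    ← (hsigma.congr_fun fun m => hfiber (f m) m).unique h]
  exact hsum.hasSum

end Sums

section Coefficients

/-- The coefficient `I_m(2√2 t) / 2^{m/2}` with which the closed geodesics of length `m`, primitive
or not, contribute to the trace formula. -/
noncomputable def traceCoeff (t : ℝ) (m : ℕ) : ℝ := besselI m (2 * √2 * t) / √2 ^ m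

theorem FTerm_eq_traceCoeff (l : ℕ) (t : ℝ) (k : ℕ) : FTerm l t k = traceCoeff t (k * l) := by
  rw [FTerm, traceCoeff, Real.sqrt_eq_rpow, ← Real.rpow_natCast, ← Real.rpow_mul zero_le_two,
    Nat.cast_mul, one_div_mul_eq_div]

theorem summable_abs_traceCoeff_mul_pow (t : ℝ) {y : ℝ} (hy : 0 ≤ y) :
    Summable fun m => |traceCoeff t m| * y ^ m := by
  refine (summable_abs_besselI_mul_pow (2 * √2 * t) (div_nonneg hy (Real.sqrt_nonneg 2))).congr
    fun m => ?_
  rw [traceCoeff, abs_div, abs_of_pos (by positivity : 0 < √2 ^ m), div_pow, mul_div_assoc',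
    div_mul_eq_mul_div]

theorem summable_FTerm (t : ℝ) {l : ℕ} (hl : 0 < l) :
    Summable fun k : {k : ℕ // 1 ≤ k} => FTerm l t k := by
  have h : Summable (traceCoeff t) :=
    .of_abs (by simpa using summable_abs_traceCoeff_mul_pow t zero_le_one)
  simp only [FTerm_eq_traceCoeff]
  exact h.comp_injective (i := fun k : {k : ℕ // 1 ≤ k} => (k : ℕ) * l) fun _ _ h =>
    Subtype.ext (Nat.eq_of_mul_eq_mul_right hl h)

theorem hasSum_F (t : ℝ) {l : ℕ} (hl : 0 < l) :
    HasSum (fun k : ℕ+ => traceCoeff t (k * l)) (F l t) := by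
  simp only [← FTerm_eq_traceCoeff]
  exact (summable_FTerm t hl).hasSum

theorem hasSum_traceCoeff_even (t : ℝ) :
    HasSum (fun m : ℕ => if Even m then traceCoeff t m else 0)
      (2 * besselI 0 (2 * √2 * t) - J t) := by
  have hinj : Function.Injective fun j : ℕ => 2 * j := mul_right_injective₀ two_ne_zero
  refine (hinj.hasSum_iff fun m hm => if_neg fun h => hm ?_).mp ?_
  · exact h.two_dvd.imp fun _ => Eq.symm
  · refine (hasSum_besselI_two_mul_div_two_pow t).congr_fun fun j => ?_
    rw [Function.comp_apply, if_pos (even_two_mul j), traceCoeff, pow_mul,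
      Real.sq_sqrt zero_le_two]

theorem hasSum_besselI_mul_trace_dickson {n : Type*} [Fintype n] [DecidableEq n]
    {A : Matrix n n ℝ} (hA : A.IsHermitian) {a : ℝ} (ha : 0 < a) (t : ℝ) :
    HasSum (fun m => besselI m (2 * √a * t) / √a ^ m *
        (Polynomial.aeval A (Polynomial.dickson 1 a m)).trace)
      (∑ i, Real.exp (t * hA.eigenvalues i) + Fintype.card n * besselI 0 (2 * √a * t)) := by
  have h := hasSum_sum (s := Finset.univ) fun i _ =>
    hasSum_besselI_mul_dickson ha t (hA.eigenvalues i)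
  rw [Finset.sum_add_distrib, Finset.sum_const, Finset.card_univ, nsmul_eq_mul] at h
  refine h.congr_fun fun m => ?_
  rw [trace_aeval_eq_sum_eigenvalues hA, Finset.mul_sum]
  rfl

end Coefficients

section Graph

variable {V : Type*} (G : SimpleGraph V)

theorem ncard_periodic_nonbacktracking_le [Finite V] (m : ℕ) [NeZero m] :
    {c | IsNonbacktracking G c ∧ Function.Periodic c (m : ℤ)}.ncard ≤ Nat.card V ^ m := by
  rw [← ncard_setOf_periodic]
  exact Set.ncard_le_ncard (fun c hc => hc.2) (finite_setOf_periodic V m)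

theorem summable_abs_traceCoeff_mul_ncard [Finite V] (t : ℝ) :
    Summable fun m : ℕ+ => |traceCoeff t m| *
      {c | IsNonbacktracking G c ∧ Function.Periodic c (m : ℕ)}.ncard := by
  refine .of_nonneg_of_le (fun m => by positivity) (fun m => ?_)
    ((summable_abs_traceCoeff_mul_pow t (Nat.cast_nonneg (Nat.card V))).comp_injective
      PNat.coe_injective)
  rw [Function.comp_apply]
  gcongr
  exact_mod_cast ncard_periodic_nonbacktracking_le G m

variable [Fintype V] [DecidableEq V] [DecidableRel G.Adj]

theorem hasSum_traceCoeff_mul_trace_add (t : ℝ) :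
    HasSum (fun m : ℕ => traceCoeff t m *
        ((Polynomial.aeval (G.adjMatrix ℝ) (Polynomial.dickson 1 (2 : ℝ) m)).trace +
          if Even m then (Fintype.card V : ℝ) else 0))
      (∑ i, Real.exp (t * eigenvalue G i) +
        Fintype.card V * (3 * besselI 0 (2 * √2 * t) - J t)) := by
  have htrace := hasSum_besselI_mul_trace_dickson (G.isHermitian_adjMatrix ℝ) zero_lt_two t
  have h := htrace.add ((hasSum_traceCoeff_even t).mul_left (Fintype.card V : ℝ))
  rw [add_assoc, ← mul_add, ← add_sub_assoc, ← one_add_mul, show (1 + 2 : ℝ) = 3 by norm_num] at h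
  refine h.congr_fun fun m => ?_
  rw [traceCoeff]
  split_ifs <;> ring

theorem hasSum_traceCoeff_mul_ncard (hG : G.IsRegularOfDegree 3) (t : ℝ) :
    HasSum (fun m : ℕ+ => traceCoeff t m *
        {c | IsNonbacktracking G c ∧ Function.Periodic c (m : ℕ)}.ncard)
      (∑ i, Real.exp (t * eigenvalue G i) - Fintype.card V * J t) := by
  have hzero : traceCoeff t 0 *
      ((Polynomial.aeval (G.adjMatrix ℝ) (Polynomial.dickson 1 (2 : ℝ) 0)).trace +
        if Even 0 then (Fintype.card V : ℝ) else 0) =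
      3 * Fintype.card V * besselI 0 (2 * √2 * t) := by
    rw [aeval_dickson_zero, Matrix.trace_smul, Matrix.trace_one, if_pos Even.zero, traceCoeff,
      smul_eq_mul]
    ring
  have h := (hasSum_nat_add_iff' 1).mpr (hasSum_traceCoeff_mul_trace_add G t)
  rw [Finset.sum_range_one, hzero, mul_sub, ← mul_assoc, mul_comm (Fintype.card V : ℝ) 3,
    add_sub_right_comm, sub_add_sub_cancel] at h
  refine Equiv.pnatEquivNat.symm.hasSum_iff.mp (h.congr_fun fun m => ?_)
  have hN := ncard_periodic_nonbacktracking G ℝ (q := 2) hG m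
  rw [Nat.cast_two, show (2 : ℝ) - 1 = 1 by norm_num, one_mul] at hN
  exact congrArg (traceCoeff t (m + 1) * ·) hN

theorem hasSum_F_mul_multiplicity (hG : G.IsRegularOfDegree 3) (t : ℝ) :
    HasSum (fun l : ℕ+ => F l t * (2 * (l : ℕ) * multiplicity G l))
      (∑ i, Real.exp (t * eigenvalue G i) - Fintype.card V * J t) := by
  have hN (m : ℕ+) : (({c | IsNonbacktracking G c ∧ Function.Periodic c (m : ℕ)}.ncard : ℕ) : ℝ) =
      ∑ l ∈ (m : ℕ).divisors, 2 * (l : ℝ) * multiplicity G l := by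
    exact_mod_cast ncard_periodic_nonbacktracking_eq_sum_divisors m
  have hpairs := hasSum_prod_of_hasSum_mul_sum_divisors
    (g := fun l => 2 * (l : ℝ) * multiplicity G l) (fun l => by positivity)
    ((summable_abs_traceCoeff_mul_ncard G t).congr fun m => by rw [hN])
    ((hasSum_traceCoeff_mul_ncard G hG t).congr_fun fun m => by rw [hN])
  exact hpairs.prod_fiberwise fun l => (hasSum_F t l.pos).mul_right _

theorem hasSum_mul_multiplicity_mul_F (hG : G.IsRegularOfDegree 3) (t : ℝ) :
    HasSum (fun l : {l : ℕ // 3 ≤ l} => (l : ℝ) * (multiplicity G l : ℝ) * F l t)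
      ((∑ i, Real.exp (t * eigenvalue G i) - Fintype.card V * J t) / 2) := by
  have hinj : Function.Injective (β := ℕ+) fun l : {l : ℕ // 3 ≤ l} =>
      ⟨l, zero_lt_three.trans_le l.2⟩ := fun _ _ h => Subtype.ext (congrArg PNat.val h)
  have h := (hinj.hasSum_iff fun l hl => ?_).mpr (hasSum_F_mul_multiplicity G hG t)
  · refine (h.div_const 2).congr_fun fun l => ?_
    change _ = F l t * (2 * (l : ℕ) * multiplicity G l) / 2
    ring
  · have hl3 : (l : ℕ) < 3 := not_le.mp fun h => hl ⟨⟨l, h⟩, rfl⟩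
    rw [multiplicity_eq_zero_of_lt G hl3, Nat.cast_zero, mul_zero, mul_zero]

theorem expAverage_eq [Nonempty V] (hG : G.IsRegularOfDegree 3) (t : ℝ) :
    expAverage G t = J t + 2 / (Fintype.card V : ℝ) * ∑' l : {l : ℕ // 3 ≤ l},
      (l : ℝ) * (multiplicity G l : ℝ) * F l t := by
  rw [(hasSum_mul_multiplicity_mul_F G hG t).tsum_eq, expAverage]
  have : (Fintype.card V : ℝ) ≠ 0 := by positivity
  field_simp
  ring

theorem mean_eq_expAverage : mean G = expAverage G (1 / 3) := by
  simp only [mean, expAverage, one_div_mul_eq_div]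

theorem variance_eq [Nonempty V] : variance G = expAverage G (2 / 3) - mean G ^ 2 := by
  rw [variance, one_div_card_mul_sum_sub_sq _ (by rw [mean]), expAverage]
  simp only [← Real.exp_nat_mul]
  congr 4 with i
  ring_nf

end Graph

end CubicTrace

theorem mainTheorem1 {V : Type*} [Fintype V] [DecidableEq V] [Nonempty V]
    (G : SimpleGraph V) [DecidableRel G.Adj] (hG : G.IsRegularOfDegree 3) :
    -- all objects in the formula are well defined
    (∀ γ : CubicTrace.ClosedPath G, γ.IsClosedGeodesic → 3 ≤ γ.length) ∧
    (∀ ℓ : ℕ, (CubicTrace.primitiveGeodesics G ℓ).Finite) ∧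
    (∀ (m : ℕ) (z : ℝ), Summable (CubicTrace.besselITerm m z)) ∧
    (∀ t : ℝ, IntervalIntegrable (CubicTrace.JIntegrand t) MeasureTheory.volume
      (-(2 * √2)) (2 * √2)) ∧
    (∀ (ℓ : ℕ) (t : ℝ), 3 ≤ ℓ →
      Summable (fun k : {k : ℕ // 1 ≤ k} => CubicTrace.FTerm ℓ t k)) ∧
    (∀ t : ℝ, Summable (fun ℓ : {ℓ : ℕ // 3 ≤ ℓ} =>
      (ℓ : ℝ) * (CubicTrace.multiplicity G ℓ : ℝ) * CubicTrace.F ℓ t)) ∧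
    -- the trace formula
    (∀ t : ℝ, CubicTrace.expAverage G t = CubicTrace.J t +
      2 / (Fintype.card V : ℝ) * ∑' ℓ : {ℓ : ℕ // 3 ≤ ℓ},
        (ℓ : ℝ) * (CubicTrace.multiplicity G ℓ : ℝ) * CubicTrace.F ℓ t) ∧
    -- the mean
    CubicTrace.mean G = CubicTrace.J (1 / 3) +
      2 / (Fintype.card V : ℝ) * ∑' ℓ : {ℓ : ℕ // 3 ≤ ℓ},
        (ℓ : ℝ) * (CubicTrace.multiplicity G ℓ : ℝ) * CubicTrace.F ℓ (1 / 3) ∧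
    -- the variance
    CubicTrace.variance G = CubicTrace.J (2 / 3) +
      2 / (Fintype.card V : ℝ) * (∑' ℓ : {ℓ : ℕ // 3 ≤ ℓ},
        (ℓ : ℝ) * (CubicTrace.multiplicity G ℓ : ℝ) * CubicTrace.F ℓ (2 / 3)) -
      CubicTrace.mean G ^ 2 ∧
    -- the variance, with the part linear in the multiplicities and the quadratic term separated
    CubicTrace.variance G = (CubicTrace.J (2 / 3) - CubicTrace.J (1 / 3) ^ 2) +
      2 / (Fintype.card V : ℝ) * (∑' ℓ : {ℓ : ℕ // 3 ≤ ℓ},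
        (ℓ : ℝ) * (CubicTrace.multiplicity G ℓ : ℝ) *
          (CubicTrace.F ℓ (2 / 3) - 2 * CubicTrace.J (1 / 3) * CubicTrace.F ℓ (1 / 3))) -
      (2 / (Fintype.card V : ℝ) * ∑' ℓ : {ℓ : ℕ // 3 ≤ ℓ},
        (ℓ : ℝ) * (CubicTrace.multiplicity G ℓ : ℝ) * CubicTrace.F ℓ (1 / 3)) ^ 2 := by
  have hsum (t : ℝ) := (CubicTrace.hasSum_mul_multiplicity_mul_F G hG t).summable
  have hmean := CubicTrace.mean_eq_expAverage G
  have hvar := CubicTrace.variance_eq G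
  rw [CubicTrace.expAverage_eq G hG] at hmean hvar
  refine ⟨fun _ => CubicTrace.three_le_length_of_isClosedGeodesic,
    CubicTrace.finite_primitiveGeodesics, CubicTrace.summable_besselITerm,
    CubicTrace.intervalIntegrable_JIntegrand,
    fun _ t hl => CubicTrace.summable_FTerm t (zero_lt_three.trans_le hl), hsum,
    CubicTrace.expAverage_eq G hG, hmean, hvar, ?_⟩
  rw [hvar, hmean, CubicTrace.tsum_mul_sub_mul (hsum (2 / 3)) (hsum (1 / 3))]
  ring
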